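/- Let $r$ be a prime number. Link diagrams are (non-empty) diagrams on the oriented plane or sphere, considered as combinatorial objects: plane 4-valent graphs, possibly with crossingless circles, with the counterclockwise order of the edges at every crossing and the upper strand at every crossing recorded. A $Z_r$-symmetry of a diagram $D$ is an automorphism $\varphi$ of $D$ (preserving the graph, the counterclockwise orders and the upper strands) with $\varphi^r=\mathrm{id}$; the main example is the rotation by $2\pi/r$ of a diagram in $\mathbb R^2\setminus\{0\}$ that is invariant under it. If $D$ is oriented, $\varphi$ is required to preserve the orientation or to reverse it on all components. Let $c$ be a crossing of $D$ with $\varphi(c)\neq c$, so that the orbit $c,\varphi(c),\dots,\varphi^{r-1}(c)$ consists of $r$ crossings. (i) The HOMFLYPT polynomial $P_L(a,z)\in\mathbb Z[a^{\pm1},z^{\pm1}]$ is the invariant of oriented links with $P=1$ for the trivial knot and $aP_{L_+}+a^{-1}P_{L_-}=zP_{L_0}$, where $L_+$, $L_-$, $L_0$ differ only near one crossing, which is positive, negative, and smoothed in accordance with the orientation, respectively. Let $L_{sym(+)}$ be an oriented diagram with a $Z_r$-symmetry $\varphi$ and a positive crossing $c$ as above, and let $L_{sym(-)}$ and $L_{sym(0)}$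 be obtained from it by changing, respectively by smoothing in accordance with the orientation, all the crossings in the orbit of $c$. Then $$a^rP_{L_{sym(+)}}(a,z)+a^{-r}P_{L_{sym(-)}}(a,z)\equiv z^rP_{L_{sym(0)}}(a,z)\pmod r$$ in $\mathbb Z[a^{\pm1},z^{\pm1}]$. Likewise, for the normalization $P_L(v,z)\in\mathbb Z[v^{\pm1},z^{\pm1}]$ with $P=1$ for the trivial knot and $v^{-1}P_{L_+}-vP_{L_-}=zP_{L_0}$, $$v^{-r}P_{L_{sym(+)}}(v,z)-v^{r}P_{L_{sym(-)}}(v,z)\equiv z^rP_{L_{sym(0)}}(v,z)\pmod r .$$ (ii) The Kauffman polynomial $\Lambda_D(a,z)\in\mathbb Z[a^{\pm1},z^{\pm1}]$ of unoriented diagrams is the regular isotopy invariant (invariant under the second and third Reidemeister moves) with value $1$ on the circle without crossings, which is multiplied by $a$ (by $a^{-1}$) when a positive (negative) kink is added, and with $\Lambda_{D_+}+\Lambda_{D_-}=z(\Lambda_{D_0}+\Lambda_{D_\infty})$, where $D_+$, $D_-$, $D_0$, $D_\infty$ differ only near one crossing: $D_-$ is obtained from $D_+$ by changing it, and $D_0$,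 $D_\infty$ by smoothing it in the two possible ways. Let $D_{sym(+)}$ be an unoriented diagram with a $Z_r$-symmetry $\varphi$ and a crossing $c$ as above, and let $D_{sym(-)}$, $D_{sym(0)}$, $D_{sym(\infty)}$ be obtained from it by replacing all the crossings in the orbit of $c$ in the corresponding one of these ways (the regions swept by the upper strand rotated counterclockwise are merged in $D_{sym(0)}$, the other two regions in $D_{sym(\infty)}$, at every crossing of the orbit). Then $$\Lambda_{D_{sym(+)}}+\Lambda_{D_{sym(-)}}\equiv z^r\left(\Lambda_{D_{sym(0)}}+\Lambda_{D_{sym(\infty)}}\right)\pmod r .$$ -/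

import Mathlib

/-!
Link diagrams are encoded as combinatorial maps on the oriented sphere.
The underlying plane graph has vertices of valency four (the crossings) and of valency
two (marked points on the strands, so that circles without crossings are allowed).
`E` is the set of darts, that is of half-edges pointing away from a vertex.
-/

/-- The number of cycles of a permutation, fixed points included. -/
noncomputable def numCycles {E : Type} (f : Equiv.Perm E) : ℕ :=
  Nat.card (Quotient (Equiv.Perm.SameCycle.setoid f))

/-- The number of orbits of the group generated by two permutations. -/
noncomputable def numOrbits {E : Type} (f g : Equiv.Perm E) : ℕ :=
  Nat.card (MulAction.orbitRel.Quotient (Subgroup.closure {f, g}) E)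

/-- An unoriented link diagram with set of darts `E`. -/
structure LinkDiagram (E : Type) where
  finite : Finite E
  nonempty : Nonempty E
  /-- the other half of the edge -/
  edge : Equiv.Perm E
  edge_edge : ∀ e, edge (edge e) = e
  edge_ne : ∀ e, edge e ≠ e
  /-- the next dart at the same vertex in the counterclockwise direction -/
  next : Equiv.Perm E
  next_ne : ∀ e, next e ≠ e
  next_four : ∀ e, next (next (next (next e))) = e
  /-- `upper e` : the dart `e` belongs to the upper strand of a crossing -/
  upper : E → Prop
  upper_crossing : ∀ e, next (next e) ≠ e → (upper (next e) ↔ ¬ upper e)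
  upper_marked : ∀ e, next (next e) = e → ¬ upper e
  /-- Euler's formula (vertices) + (faces) = (edges) + 2 (connected components): every
  connected component of the graph lies on a sphere. -/
  planar : numCycles next + numCycles (next * edge) = numCycles edge + 2 * numOrbits next edge

/-- An oriented link diagram: `out e` says that the strand through `e` leaves the vertex
along `e`. Strands go straight through crossings. -/
structure OrientedDiagram (E : Type) extends LinkDiagram E where
  out : E → Prop
  out_edge : ∀ e, out (edge e) ↔ ¬ out e
  out_crossing : ∀ e, next (next e) ≠ e → (out (next (next e)) ↔ ¬ out e)
  out_marked : ∀ e, next (next e) = e → (out (next e) ↔ ¬ out e)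

namespace LinkDiagram

variable {E E' : Type}

/-- The dart `e` starts at a crossing. -/
def IsCrossing (D : LinkDiagram E) (e : E) : Prop := D.next (D.next e) ≠ e

/-- All the darts at the vertex at which `d` starts. -/
def vertex (D : LinkDiagram E) (d : E) : Set E := {e | D.next.SameCycle d e}

/-- All the darts at the vertices `c, φ c, φ (φ c), …`, where `d` starts at `c`. -/
def orbit (D : LinkDiagram E) (φ : Equiv.Perm E) (d : E) : Set E :=
  {e | ∃ i : ℕ, D.next.SameCycle ((φ ^ i) d) e}

/-- A circle without crossings. -/
def IsCircle (D : LinkDiagram E) : Prop :=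
  (∀ e, ¬ D.IsCrossing e) ∧ numOrbits D.next D.edge = 1

/-- `f` is an isomorphism of diagrams (preserving the orientation of the sphere). -/
structure IsIso (D : LinkDiagram E) (D' : LinkDiagram E') (f : E ≃ E') : Prop where
  edge : ∀ e, D'.edge (f e) = f (D.edge e)
  next : ∀ e, D'.next (f e) = f (D.next e)
  upper : ∀ e, D'.upper (f e) ↔ D.upper e

/-- `D'` is `D` with a new marked point (with darts `p` and `q`) on the edge of `e`. -/
structure IsSubdivision (D : LinkDiagram E) (D' : LinkDiagram E') (ι : E → E')
    (e : E) (p q : E') : Prop where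
  injective : Function.Injective ι
  cover : ∀ x, x = p ∨ x = q ∨ x ∈ Set.range ι
  new_left : p ∉ Set.range ι
  new_right : q ∉ Set.range ι
  next_left : D'.next p = q
  next_right : D'.next q = p
  next_old : ∀ x, D'.next (ι x) = ι (D.next x)
  edge_left : D'.edge (ι e) = p
  edge_right : D'.edge (ι (D.edge e)) = q
  edge_old : ∀ x, x ≠ e → x ≠ D.edge e → D'.edge (ι x) = ι (D.edge x)
  upper_old : ∀ x, D'.upper (ι x) ↔ D.upper x

/-- `D'` is `D` with the upper and the lower strand exchanged at the crossings
with darts in `S`. -/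
structure IsSwitch (D D' : LinkDiagram E) (S : Set E) : Prop where
  edge : D'.edge = D.edge
  next : D'.next = D.next
  upper_inside : ∀ e ∈ S, (D'.upper e ↔ ¬ D.upper e)
  upper_outside : ∀ e ∉ S, (D'.upper e ↔ D.upper e)

/-- `D'` is `D` with the crossings with darts in `S` smoothed: each of them becomes two
marked points, a dart in `M` being joined to its counterclockwise neighbour and
a dart outside `M` to its clockwise neighbour. -/
structure IsSmoothing (D D' : LinkDiagram E) (S M : Set E) : Prop where
  edge : D'.edge = D.edge
  next_mem : ∀ e ∈ S, e ∈ M → D'.next e = D.next e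
  next_notMem : ∀ e ∈ S, e ∉ M → D'.next e = D.next.symm e
  next_outside : ∀ e ∉ S, D'.next e = D.next e
  upper_outside : ∀ e ∉ S, (D'.upper e ↔ D.upper e)

/-- First Reidemeister move: `D` has a kink whose loop leaves and enters its crossing
along `d` and `next d`, and `D'` is `D` with this kink removed (the crossing is
opened so that the loop becomes part of an uncrossed strand). -/
structure IsKinkRemoval (D D' : LinkDiagram E) (d : E) : Prop where
  crossing : D.IsCrossing d
  loop : D.edge d = D.next d
  smoothing : D.IsSmoothing D' (D.vertex d) {D.next d, D.next (D.next (D.next d))}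

/-- Second Reidemeister move: `x, next x` and `y, next y` bound a bigon of `D` between two
strands one of which is above the other at both crossings, and
`D'` is `D` with the two strands pulled apart. -/
structure IsBigonRemoval (D D' : LinkDiagram E) (x y : E) : Prop where
  crossing_left : D.IsCrossing x
  crossing_right : D.IsCrossing y
  edge_left : D.edge x = D.next y
  edge_right : D.edge (D.next x) = y
  same_level : D.upper x ↔ D.upper (D.next y)
  smoothing : D.IsSmoothing D' (D.vertex x ∪ D.vertex y)
    {D.next x, D.next (D.next (D.next x)), D.next y, D.next (D.next (D.next y))}

open Classical in
/-- Exchange of the two crossings along the strand that passes through the edge from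
`next a` to `b`. -/
noncomputable def strandSwap (D : LinkDiagram E) (a b : E) : Equiv.Perm E :=
  Equiv.swap (D.next.symm a) b * Equiv.swap (D.next a) (D.next (D.next b))

/-- The permutation of the twelve darts at the corners of a triangle that exchanges the
two crossings on each of the three strands. -/
noncomputable def triangleSwap (D : LinkDiagram E) (a b c : E) : Equiv.Perm E :=
  D.strandSwap a b * D.strandSwap b c * D.strandSwap c a

/-- Third Reidemeister move: `D` has a triangle with three different crossings as corners,
lying between `a, next a`, between `b, next b` and between `c, next c`; the strand through
the first two corners is above the other two strands; and
in `D'` the order of the two crossings along each of the three strands is reversed. -/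
structure IsTriangleMove (D D' : LinkDiagram E) (a b c : E) : Prop where
  crossing_a : D.IsCrossing a
  crossing_b : D.IsCrossing b
  crossing_c : D.IsCrossing c
  ne_ab : ¬ D.next.SameCycle a b
  ne_bc : ¬ D.next.SameCycle b c
  ne_ca : ¬ D.next.SameCycle c a
  edge_ab : D.edge (D.next a) = b
  edge_bc : D.edge (D.next b) = c
  edge_ca : D.edge (D.next c) = a
  top_a : D.upper (D.next a)
  top_b : D.upper b
  next : D'.next = D.next
  upper : ∀ e, D'.upper e ↔ D.upper e
  edge : D'.edge = D.triangleSwap a b c * D.edge * D.triangleSwap a b c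

/-- `Dp`, `Dm`, `D0`, `Dinf` are equal away from the darts in `S`, which all start at
crossings of `Dp`; these crossings are switched in `Dm` and are smoothed
in `D0` and `Dinf` in the two possible ways: in `D0` the two regions swept by rotating
the upper strand counterclockwise are merged, in `Dinf` the other two. -/
structure IsSkeinQuadruple (Dp Dm D0 Dinf : LinkDiagram E) (S : Set E) : Prop where
  crossing : ∀ e ∈ S, Dp.IsCrossing e
  switch : Dp.IsSwitch Dm S
  smoothing_zero : Dp.IsSmoothing D0 S {e | ¬ Dp.upper e}
  smoothing_inf : Dp.IsSmoothing Dinf S {e | Dp.upper e}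

end LinkDiagram

namespace OrientedDiagram

variable {E : Type}

/-- `Dp`, `Dm`, `D0` are equal away from the darts in `S`, which all start at positive
crossings of `Dp` (the upper outgoing strand, rotated counterclockwise, comes to the
lower outgoing strand); these crossings are replaced by negative
crossings in `Dm` and are smoothed in accordance with the orientation in `D0`. -/
structure IsSkeinTriple (Dp Dm D0 : OrientedDiagram E) (S : Set E) : Prop where
  crossing : ∀ e ∈ S, Dp.IsCrossing e
  positive : ∀ e ∈ S, Dp.out e → Dp.out (Dp.next e) → Dp.upper e
  switch : Dp.IsSwitch Dm.toLinkDiagram S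
  switch_out : ∀ e, Dm.out e ↔ Dp.out e
  smoothing : Dp.IsSmoothing D0.toLinkDiagram S {e | ¬ (Dp.out (Dp.next e) ↔ Dp.out e)}
  smoothing_out : ∀ e, D0.out e ↔ Dp.out e

end OrientedDiagram

/-- Laurent polynomials with integer coefficients in two variables. -/
abbrev Laurent2 : Type := LaurentPolynomial (LaurentPolynomial ℤ)

/-- The power with exponent `n` of the first variable (called `a` or `v`). -/
noncomputable def aPow (n : ℤ) : Laurent2 := LaurentPolynomial.C (LaurentPolynomial.T n)

/-- The power with exponent `n` of the second variable `z`. -/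
noncomputable def zPow (n : ℤ) : Laurent2 := LaurentPolynomial.T n

/-- `P` is an invariant of oriented links (it is unchanged under isomorphisms,
marked points and Reidemeister moves) with value `1` on the trivial knot and with
`s * P(Dp) + t * P(Dm) = z * P(D0)`. -/
structure IsSkeinPolynomial (s t : Laurent2)
    (P : ∀ E : Type, OrientedDiagram E → Laurent2) : Prop where
  iso : ∀ (E E' : Type) (D : OrientedDiagram E) (D' : OrientedDiagram E') (f : E ≃ E'),
    D.IsIso D'.toLinkDiagram f → (∀ e, D'.out (f e) ↔ D.out e) → P E' D' = P E D
  subdivision : ∀ (E E' : Type) (D : OrientedDiagram E) (D' : OrientedDiagram E')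
    (ι : E → E') (e : E) (p q : E'), D.IsSubdivision D'.toLinkDiagram ι e p q →
    (∀ x, D'.out (ι x) ↔ D.out x) → P E' D' = P E D
  kink : ∀ (E : Type) (D D' : OrientedDiagram E) (d : E),
    D.IsKinkRemoval D'.toLinkDiagram d →
    (∀ e, e ∉ ({d, D.next d} : Set E) → (D'.out e ↔ D.out e)) → P E D' = P E D
  bigon : ∀ (E : Type) (D D' : OrientedDiagram E) (x y : E),
    D.IsBigonRemoval D'.toLinkDiagram x y →
    (∀ e, e ∉ ({x, D.next x, y, D.next y} : Set E) → (D'.out e ↔ D.out e)) → P E D' = P E D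
  triangle : ∀ (E : Type) (D D' : OrientedDiagram E) (a b c : E),
    D.IsTriangleMove D'.toLinkDiagram a b c → (∀ e, D'.out e ↔ D.out e) → P E D' = P E D
  unknot : ∀ (E : Type) (D : OrientedDiagram E), D.IsCircle → P E D = 1
  skein : ∀ (E : Type) (Dp Dm D0 : OrientedDiagram E) (d : E),
    Dp.IsSkeinTriple Dm D0 (Dp.vertex d) → s * P E Dp + t * P E Dm = zPow 1 * P E D0

/-- `Q` is the polynomial of unoriented diagrams of Kauffman: unchanged under isomorphisms,
marked points and the second and third Reidemeister moves, multiplied by `a` (by `a⁻¹`)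
when a positive (negative) kink is added, equal to `1` on a circle, and
with the sum of the values on the two crossings equal to `z` times the sum of the values
on the two smoothings. -/
structure IsKauffmanPolynomial (Q : ∀ E : Type, LinkDiagram E → Laurent2) : Prop where
  iso : ∀ (E E' : Type) (D : LinkDiagram E) (D' : LinkDiagram E') (f : E ≃ E'),
    D.IsIso D' f → Q E' D' = Q E D
  subdivision : ∀ (E E' : Type) (D : LinkDiagram E) (D' : LinkDiagram E')
    (ι : E → E') (e : E) (p q : E'), D.IsSubdivision D' ι e p q → Q E' D' = Q E D
  kink_positive : ∀ (E : Type) (D D' : LinkDiagram E) (d : E),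
    D.IsKinkRemoval D' d → D.upper (D.next d) → Q E D = aPow 1 * Q E D'
  kink_negative : ∀ (E : Type) (D D' : LinkDiagram E) (d : E),
    D.IsKinkRemoval D' d → D.upper d → Q E D = aPow (-1) * Q E D'
  bigon : ∀ (E : Type) (D D' : LinkDiagram E) (x y : E),
    D.IsBigonRemoval D' x y → Q E D' = Q E D
  triangle : ∀ (E : Type) (D D' : LinkDiagram E) (a b c : E),
    D.IsTriangleMove D' a b c → Q E D' = Q E D
  unknot : ∀ (E : Type) (D : LinkDiagram E), D.IsCircle → Q E D = 1
  skein : ∀ (E : Type) (Dp Dm D0 Dinf : LinkDiagram E) (d : E),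
    Dp.IsSkeinQuadruple Dm D0 Dinf (Dp.vertex d) →
    Q E Dp + Q E Dm = zPow 1 * (Q E D0 + Q E Dinf)

open Classical in
/-- The skein polynomial with skein relation `s * P(Dp) + t * P(Dm) = z * P(D0)`, as the
unique invariant that the relation characterizes. (For `s = a`, `t = a⁻¹` and for
`s = v⁻¹`, `t = -v` it is a classical theorem that there is exactly one.) -/
noncomputable def skeinPolynomial (s t : Laurent2) {E : Type} (D : OrientedDiagram E) : Laurent2 :=
  if h : ∃! P, IsSkeinPolynomial s t P then h.choose E D else 0

/-- The HOMFLYPT polynomial `P(a, z)` with `a P(Dp) + a⁻¹ P(Dm) = z P(D0)`. -/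
noncomputable def homflypt {E : Type} (D : OrientedDiagram E) : Laurent2 :=
  skeinPolynomial (aPow 1) (aPow (-1)) D

/-- The HOMFLYPT polynomial `P(v, z)` with `v⁻¹ P(Dp) - v P(Dm) = z P(D0)`. -/
noncomputable def homflyptV {E : Type} (D : OrientedDiagram E) : Laurent2 :=
  skeinPolynomial (aPow (-1)) (-aPow 1) D

open Classical in
/-- The polynomial `Λ(a, z)` of unoriented diagrams, as the unique function that its
defining relations characterize. (That there is exactly one is a classical theorem.) -/
noncomputable def kauffmanPolynomial {E : Type} (D : LinkDiagram E) : Laurent2 :=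
  if h : ∃! Q, IsKauffmanPolynomial Q then h.choose E D else 0

/-- `φ` generates an action of the cyclic group of order `r` on the diagram `D`. -/
structure IsPeriodic {E : Type} (D : LinkDiagram E) (r : ℕ) (φ : Equiv.Perm E) : Prop where
  symmetry : D.IsIso D φ
  pow_eq_one : φ ^ r = 1

/-- `φ` generates an action of the cyclic group of order `r` on the oriented diagram `D`,
preserving the orientation or reversing it on all components. -/
structure IsPeriodicOriented {E : Type} (D : OrientedDiagram E) (r : ℕ)
    (φ : Equiv.Perm E) : Prop where
  periodic : IsPeriodic D.toLinkDiagram r φ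
  orientation : (∀ e, D.out (φ e) ↔ D.out e) ∨ (∀ e, D.out (φ e) ↔ ¬ D.out e)

/-!
Let `D` be a diagram with a symmetry `φ` of prime order `r` and a crossing that is moved by `φ`.
As `r` is prime, the `r` crossings of its orbit are different. Each of them can be kept, switched or
smoothed independently of the others, so that every function `σ` from `ZMod r` to a finite set of
local states gives a diagram `D_σ`. The rotation of the diagram by `φ` shows that the polynomial of
`D_σ` does not change if `σ` is shifted cyclically.

The skein relation at one crossing has the form `∑ k, α k * W k = ∑ k, β k * W k`, where `k` runs
through the states of that crossing. Applied at all the crossings of the orbit, it gives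
`∑ σ, (∏ i, α (σ i)) * W σ = ∑ σ, (∏ i, β (σ i)) * W σ` (`sum_prod_mul_eq_of_local`). Both sums are
invariant under the cyclic shift, whose orbits have `1` or `r` elements, and only the constant `σ`
are fixed. Modulo `r` there remains `∑ k, α k ^ r * W (const k) = ∑ k, β k ^ r * W (const k)`
(`sum_pow_mul_sub_mem_span`), which is the claim for the weights `(s, t, 0)` and `(0, 0, z)` of a
skein polynomial, and for `(1, 1, 0, 0)` and `(0, 0, z, z)` of the Kauffman polynomial.

The diagrams `D_σ` have to be plane (`LinkDiagram.IsColoring.planar`). To smooth a crossing is to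
cut its vertex in two, that is to multiply the permutation `next` by a transposition. This changes
the numbers of vertices, faces and components in such a way that the genus does not increase
(`numCycles_add_numCycles_le_of_split`). Cutting all the vertices until none is left to be cut shows
that the genus is never negative (`numCycles_add_numCycles_le`), so that it stays zero
(`planar_of_split`).

If `φ` reverses the orientation of an oriented diagram, it is an isomorphism onto the reversed
diagram. The polynomial does not notice the reversal of all orientations: the reversed polynomial has
the same defining properties, and they determine it (`IsSkeinPolynomial.reverse`).

The polynomials are defined by means of their existence and uniqueness. The congruences are proved
for arbitrary functions with the defining properties (`IsSkeinPolynomial.periodic`, where the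
invariance under reversal is assumed, and `IsKauffmanPolynomial.periodic`) and do not depend on a
construction of the polynomials.
-/

open Equiv.Perm Equiv

/-! ### Numbers of classes and of cycles -/

/-- The equivalence relation that identifies `x` and `y` and nothing else. -/
def Setoid.glue {E : Type} (x y : E) : Setoid E :=
  Relation.EqvGen.setoid fun a b => a = x ∧ b = y

theorem Setoid.glue_le_iff {E : Type} {x y : E} {s : Setoid E} : Setoid.glue x y ≤ s ↔ s x y := by
  constructor
  · intro h
    exact h (Relation.EqvGen.rel _ _ ⟨rfl, rfl⟩)
  · intro h
    refine Setoid.eqvGen_le ?_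
    rintro a b ⟨rfl, rfl⟩
    exact h

theorem Setoid.sup_glue_rel {E : Type} (s : Setoid E) (x y : E) : (s ⊔ Setoid.glue x y) x y :=
  Setoid.glue_le_iff.1 le_sup_right

/-- Identifying two points in different classes decreases the number of classes by one. -/
theorem Setoid.card_sup_glue {E : Type} [Finite E] {s : Setoid E} {x y : E} (h : ¬ s x y) :
    Nat.card (Quotient (s ⊔ Setoid.glue x y)) + 1 = Nat.card (Quotient s) := by
  classical
  -- the relation is the kernel of the projection followed by moving the class of `y` to that of `x`
  let g : E → Quotient s := fun e => if s e y then Quotient.mk s x else Quotient.mk s e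
  have hker : s ⊔ Setoid.glue x y = Setoid.ker g := by
    apply le_antisymm
    · refine sup_le ?_ (Setoid.glue_le_iff.2 ?_)
      · intro a b hab
        have : s a y ↔ s b y := ⟨fun h' => s.trans' (s.symm' hab) h', fun h' => s.trans' hab h'⟩
        by_cases hb : s b y
        · simp [Setoid.ker_def, g, this, hb]
        · simp only [Setoid.ker_def, g, this, hb, if_false]
          exact Quotient.sound hab
      · simp [Setoid.ker_def, g]
    · have hle : s ≤ s ⊔ Setoid.glue x y := le_sup_left
      have hxy := Setoid.sup_glue_rel s x y
      have key : ∀ a, ∃ a', g a = Quotient.mk s a' ∧ (s ⊔ Setoid.glue x y) a a' := by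
        intro a
        by_cases ha : s a y
        · exact ⟨x, by simp [g, ha], Setoid.trans' _ (hle ha) (Setoid.symm' _ hxy)⟩
        · exact ⟨a, by simp [g, ha], Setoid.refl' _ a⟩
      intro a b hab
      obtain ⟨a', ha, haa⟩ := key a
      obtain ⟨b', hb, hbb⟩ := key b
      have : s a' b' := Quotient.exact (ha.symm.trans ((Setoid.ker_def.1 hab).trans hb))
      exact Setoid.trans' _ haa (Setoid.trans' _ (hle this) (Setoid.symm' _ hbb))
  have hrange : Set.range g = {Quotient.mk s y}ᶜ := by
    ext q
    induction q using Quotient.inductionOn with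
    | h a =>
      simp only [Set.mem_range, Set.mem_compl_iff, Set.mem_singleton_iff]
      constructor
      · rintro ⟨b, hb⟩ hay
        by_cases hby : s b y
        · simp only [g, hby, if_true] at hb
          exact h (Quotient.exact (hb.trans hay))
        · simp only [g, hby, if_false] at hb
          exact hby (Quotient.exact (hb.trans hay))
      · intro hay
        have : ¬ s a y := fun h' => hay (Quotient.sound h')
        exact ⟨a, by simp [g, this]⟩
  rw [hker, Nat.card_congr (Setoid.quotientKerEquivRange g), hrange, Nat.card_coe_set_eq,
    ← Set.ncard_add_ncard_compl {Quotient.mk s y}, Set.ncard_singleton, add_comm]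

theorem Setoid.card_le_card_sup_glue {E : Type} [Finite E] (s : Setoid E) (x y : E) :
    Nat.card (Quotient s) ≤ Nat.card (Quotient (s ⊔ Setoid.glue x y)) + 1 := by
  by_cases h : s x y
  · rw [sup_eq_left.2 (Setoid.glue_le_iff.2 h)]
    exact Nat.le_succ _
  · exact (Setoid.card_sup_glue h).ge

theorem sameCycle_setoid_le_iff {E : Type} {f : Perm E} {s : Setoid E} :
    SameCycle.setoid f ≤ s ↔ ∀ e, s e (f e) := by
  constructor
  · intro h e
    exact h (show f.SameCycle e (f e) from ⟨1, by simp⟩)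
  · rintro h a b ⟨i, rfl⟩
    induction i using Int.induction_on with
    | zero => exact s.refl' a
    | succ i ih =>
      rw [add_comm, zpow_one_add]
      exact s.trans' ih (h _)
    | pred i ih =>
      refine s.trans' ih (s.symm' ?_)
      have := h ((f ^ (-(i : ℤ) - 1)) a)
      rwa [← mul_apply, ← zpow_one_add, add_sub_cancel] at this

/-- The orbits of the group generated by two permutations are the classes of the join of their
cycle relations. -/
theorem orbitRel_closure_pair {E : Type} (f g : Perm E) :
    MulAction.orbitRel (Subgroup.closure {f, g}) E = SameCycle.setoid f ⊔ SameCycle.setoid g := by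
  apply le_antisymm
  · have hf := sameCycle_setoid_le_iff.1
      (le_sup_left : SameCycle.setoid f ≤ SameCycle.setoid f ⊔ SameCycle.setoid g)
    have hg := sameCycle_setoid_le_iff.1
      (le_sup_right : SameCycle.setoid g ≤ SameCycle.setoid f ⊔ SameCycle.setoid g)
    generalize SameCycle.setoid f ⊔ SameCycle.setoid g = s at hf hg ⊢
    rintro a b ⟨⟨w, hw⟩, rfl⟩
    change s (w b) b
    induction hw using Subgroup.closure_induction generalizing b with
    | mem w hw =>
      rcases hw with rfl | rfl
      · exact s.symm' (hf b)
      · exact s.symm' (hg b)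
    | one => exact s.refl' b
    | mul u v _ _ hu hv => exact s.trans' (hu (b := v b)) (hv (b := b))
    | inv u _ hu =>
      have := hu (b := u⁻¹ b)
      exact s.symm' (by simpa using this)
  · refine sup_le ?_ ?_ <;> refine sameCycle_setoid_le_iff.2 fun e => Setoid.symm' _ ?_
    · exact ⟨⟨f, Subgroup.subset_closure (by simp)⟩, rfl⟩
    · exact ⟨⟨g, Subgroup.subset_closure (by simp)⟩, rfl⟩

/-! ### Multiplication by a transposition and the genus -/

section transposition

variable {E : Type} [DecidableEq E]

theorem sameCycle_mul_swap_sup_glue (f : Perm E) (x y : E) :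
    SameCycle.setoid (f * swap x y) ⊔ Setoid.glue x y = SameCycle.setoid f ⊔ Setoid.glue x y := by
  have key : ∀ f : Perm E, SameCycle.setoid (f * swap x y) ⊔ Setoid.glue x y ≤
      SameCycle.setoid f ⊔ Setoid.glue x y := by
    intro f
    refine sup_le (sameCycle_setoid_le_iff.2 fun e => ?_) le_sup_right
    set s := SameCycle.setoid f ⊔ Setoid.glue x y
    have hf := sameCycle_setoid_le_iff.1 (le_sup_left : SameCycle.setoid f ≤ s)
    have hxy : s x y := Setoid.sup_glue_rel _ x y
    refine s.trans' ?_ (hf (swap x y e))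
    rcases eq_or_ne e x with rfl | hx
    · simpa using hxy
    rcases eq_or_ne e y with rfl | hy
    · simpa using s.symm' hxy
    rw [swap_apply_of_ne_of_ne hx hy]
  refine le_antisymm (key f) ?_
  simpa [mul_assoc] using key (f * swap x y)

theorem sameCycle_mul_swap_of_not_sameCycle [Finite E] {f : Perm E} {x y : E}
    (h : ¬ f.SameCycle x y) : (f * swap x y).SameCycle x y := by
  classical
  have hex : ∃ m, 0 < m ∧ (f ^ m) y = y :=
    ⟨orderOf f, orderOf_pos f, by simp [pow_orderOf_eq_one]⟩
  -- up to the first return of the cycle of `y`, the new permutation follows this cycle from `x`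
  have key : ∀ i, i + 1 ≤ Nat.find hex → ((f * swap x y) ^ (i + 1)) x = (f ^ (i + 1)) y := by
    intro i
    induction i with
    | zero => intro _; simp
    | succ i ih =>
      intro hi
      rw [pow_succ' _ (i + 1), mul_apply, ih (by omega), pow_succ' f (i + 1), mul_apply, mul_apply,
        swap_apply_of_ne_of_ne]
      · intro hx
        exact h (SameCycle.symm ⟨(i + 1 : ℕ), by rw [zpow_natCast]; exact hx⟩)
      · intro hy
        exact Nat.find_min hex (m := i + 1) (by omega) ⟨by omega, hy⟩
  obtain ⟨hpos, hret⟩ := Nat.find_spec hex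
  have := key (Nat.find hex - 1) (by omega)
  rw [Nat.sub_add_cancel hpos, hret] at this
  exact ⟨(Nat.find hex : ℕ), by rw [zpow_natCast]; exact this⟩

theorem not_sameCycle_mul_swap [Finite E] {f : Perm E} {x y : E}
    (hne : x ≠ y) (h : f.SameCycle x y) : ¬ (f * swap x y).SameCycle x y := by
  classical
  have hex : ∃ m, (f ^ m) x = y := by
    obtain ⟨i, -, hi⟩ := h.exists_pow_eq' 
    exact ⟨i, hi⟩
  set k := Nat.find hex with hk
  have hkspec : (f ^ k) x = y := Nat.find_spec hex
  have hmin : ∀ i < k, (f ^ i) x ≠ y := fun i hi => Nat.find_min hex hi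
  have hx : ∀ i, 0 < i → i ≤ k → (f ^ i) x ≠ x := by
    intro i hi hik hix
    refine hmin (k - i) (by omega) ?_
    conv_lhs => rw [← hix]
    rw [← mul_apply, ← pow_add, Nat.sub_add_cancel hik, hkspec]
  -- the arc from `f x` to `y` is closed under the new permutation
  have hclosed : ∀ n : ℕ, ∃ i, 0 < i ∧ i ≤ k ∧ ((f * swap x y) ^ n) y = (f ^ i) x := by
    intro n
    have hk0 : 0 < k := Nat.pos_of_ne_zero fun h0 => hne (by simpa [h0] using hkspec)
    induction n with
    | zero => exact ⟨k, hk0, le_rfl, by simp [hkspec]⟩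
    | succ n ih =>
      obtain ⟨i, hi, hik, hin⟩ := ih
      rw [pow_succ', mul_apply, hin]
      rcases hik.eq_or_lt with rfl | hlt
      · exact ⟨1, one_pos, hk0, by rw [hkspec]; simp⟩
      · refine ⟨i + 1, by omega, hlt, ?_⟩
        rw [mul_apply, swap_apply_of_ne_of_ne (hx i hi hik) (hmin i hlt), pow_succ', mul_apply]
  intro h'
  obtain ⟨n, -, hn⟩ := h'.symm.exists_pow_eq'
  obtain ⟨i, hi, hik, hin⟩ := hclosed n
  exact hx i hi hik (hin.symm.trans hn)

theorem numCycles_mul_swap_of_not_sameCycle [Finite E] {f : Perm E} {x y : E}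
    (h : ¬ f.SameCycle x y) : numCycles (f * swap x y) + 1 = numCycles f := by
  have h1 := Setoid.card_sup_glue (s := SameCycle.setoid f) h
  rwa [← sameCycle_mul_swap_sup_glue, sup_eq_left.2] at h1
  exact Setoid.glue_le_iff.2 (sameCycle_mul_swap_of_not_sameCycle h)

theorem numCycles_mul_swap_of_sameCycle [Finite E] {f : Perm E} {x y : E}
    (hne : x ≠ y) (h : f.SameCycle x y) : numCycles (f * swap x y) = numCycles f + 1 := by
  have h1 := numCycles_mul_swap_of_not_sameCycle (not_sameCycle_mul_swap hne h)
  rw [mul_assoc, swap_mul_self, mul_one] at h1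
  exact h1.symm

/-- Cutting a vertex in two does not increase the genus. -/
theorem numCycles_add_numCycles_le_of_split [Finite E] {f g : Perm E} {x y : E}
    (hne : x ≠ y) (h : f.SameCycle x y) :
    numCycles f + numCycles (f * g) + 2 * numOrbits (f * swap x y) g ≤
      numCycles (f * swap x y) + numCycles (f * swap x y * g) + 2 * numOrbits f g := by
  have hV := numCycles_mul_swap_of_sameCycle hne h
  have hface : f * swap x y * g = f * g * swap (g⁻¹ x) (g⁻¹ y) := by
    rw [mul_assoc, swap_mul_eq_mul_swap, mul_assoc]
  set O := MulAction.orbitRel (Subgroup.closure {f, g}) E with hO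
  set O' := MulAction.orbitRel (Subgroup.closure {f * swap x y, g}) E with hO'
  have hglue : O' ⊔ Setoid.glue x y = O := by
    have hxy : Setoid.glue x y ≤ SameCycle.setoid f := Setoid.glue_le_iff.2 h
    rw [hO, hO', orbitRel_closure_pair, orbitRel_closure_pair, sup_right_comm,
      sameCycle_mul_swap_sup_glue, sup_eq_left.2 hxy]
  have hOcard : numOrbits f g = Nat.card (Quotient (O' ⊔ Setoid.glue x y)) := by
    rw [hglue]; rfl
  have hOcard' : numOrbits (f * swap x y) g = Nat.card (Quotient O') := rfl
  by_cases hsame : (f * g).SameCycle (g⁻¹ x) (g⁻¹ y)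
  · have hF := numCycles_mul_swap_of_sameCycle (by simpa using hne) hsame
    have := Setoid.card_le_card_sup_glue O' x y
    rw [hface, hF]
    omega
  · -- two faces are merged, so that `x` and `y` remain connected
    have hF := numCycles_mul_swap_of_not_sameCycle hsame
    have hconn : O' x y := by
      have h1 := sameCycle_mul_swap_of_not_sameCycle hsame
      rw [← hface] at h1
      have hgO : ∀ e, O' e (g e) := by
        rw [hO', orbitRel_closure_pair]
        exact sameCycle_setoid_le_iff.1 le_sup_right
      have hfO : ∀ e, O' e ((f * swap x y) e) := by
        rw [hO', orbitRel_closure_pair]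
        exact sameCycle_setoid_le_iff.1 le_sup_left
      have h2 : O' (g⁻¹ x) (g⁻¹ y) := by
        refine (sameCycle_setoid_le_iff (s := O')).2 (fun e => ?_) h1
        exact O'.trans' (hgO e) (hfO _)
      have hx : O' (g⁻¹ x) x := by simpa using hgO (g⁻¹ x)
      have hy : O' (g⁻¹ y) y := by simpa using hgO (g⁻¹ y)
      exact O'.trans' (O'.symm' hx) (O'.trans' h2 hy)
    rw [sup_eq_left.2 (Setoid.glue_le_iff.2 hconn)] at hOcard
    rw [hface]
    omega

end transposition

theorem numCycles_one {E : Type} : numCycles (1 : Perm E) = Nat.card E := by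
  refine (Nat.card_congr (Equiv.ofBijective (Quotient.mk (SameCycle.setoid (1 : Perm E)))
    ⟨?_, Quotient.mk_surjective⟩)).symm
  intro a b h
  exact sameCycle_one.1 (Quotient.exact h)

theorem numOrbits_one_left {E : Type} (g : Perm E) : numOrbits 1 g = numCycles g := by
  have h : SameCycle.setoid (1 : Perm E) ≤ SameCycle.setoid g :=
    sameCycle_setoid_le_iff.2 fun e => Setoid.refl' _ _
  have := orbitRel_closure_pair 1 g
  rw [sup_eq_right.2 h] at this
  unfold numOrbits numCycles MulAction.orbitRel.Quotient
  rw [this]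

/-- The genus of a combinatorial map is not negative. -/
theorem numCycles_add_numCycles_le {E : Type} [Finite E] (f g : Perm E) :
    numCycles f + numCycles (f * g) + numCycles g ≤ Nat.card E + 2 * numOrbits f g := by
  classical
  have hbound : ∀ f : Perm E, numCycles f ≤ Nat.card E := fun f =>
    Nat.card_le_card_of_surjective _ Quotient.mk_surjective
  induction hn : Nat.card E - numCycles f using Nat.strong_induction_on generalizing f with
  | _ n ih =>
    by_cases hf : f = 1
    · subst hf
      rw [numCycles_one, one_mul, numOrbits_one_left]
      omega
    · obtain ⟨x, hx⟩ : ∃ x, f x ≠ x := by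
        by_contra! h
        exact hf (Equiv.ext h)
      have hsame : f.SameCycle x (f x) := ⟨1, by simp⟩
      have h1 := numCycles_mul_swap_of_sameCycle hx.symm hsame
      have h2 := numCycles_add_numCycles_le_of_split (g := g) hx.symm hsame
      have h3 := hbound (f * swap x (f x))
      have h4 := ih _ (by omega) (f * swap x (f x)) rfl
      omega

/-- A permutation without fixed points and with square `1` has half as many cycles as points. -/
theorem two_mul_numCycles_of_involutive {E : Type} [Finite E] {g : Perm E}
    (hinv : ∀ e, g (g e) = e) (hne : ∀ e, g e ≠ e) : 2 * numCycles g = Nat.card E := by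
  classical
  have := Fintype.ofFinite E
  have hsc : ∀ a b, g.SameCycle a b ↔ b = a ∨ b = g a := by
    intro a b
    constructor
    · let s : Setoid E := ⟨fun a b => b = a ∨ b = g a, ⟨fun a => Or.inl rfl,
        fun {a b} h => by rcases h with rfl | rfl <;> simp [hinv],
        fun {a b c} h h' => by
          rcases h with rfl | rfl <;> rcases h' with rfl | rfl <;> simp [hinv]⟩⟩
      exact fun h => (sameCycle_setoid_le_iff (s := s)).2 (fun e => Or.inr rfl) h
    · rintro (rfl | rfl)
      · exact SameCycle.refl _ _
      · exact ⟨1, by simp⟩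
  have hfib : ∀ q : Quotient (SameCycle.setoid g),
      (Finset.univ.filter fun e => Quotient.mk (SameCycle.setoid g) e = q).card = 2 := by
    intro q
    induction q using Quotient.inductionOn with
    | h a =>
      have : (Finset.univ.filter fun e => Quotient.mk (SameCycle.setoid g) e =
          Quotient.mk (SameCycle.setoid g) a) = {a, g a} := by
        ext b
        simp only [Finset.mem_filter, Finset.mem_univ, true_and, Finset.mem_insert,
          Finset.mem_singleton]
        rw [← hsc]
        exact ⟨fun h => (Quotient.exact h.symm), fun h => (Quotient.sound h).symm⟩
      rw [this, Finset.card_pair (hne a).symm]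
  have := Fintype.ofFinite (Quotient (SameCycle.setoid g))
  rw [numCycles, Nat.card_eq_fintype_card, Nat.card_eq_fintype_card, ← Finset.card_univ (α := E),
    Finset.card_eq_sum_card_fiberwise (f := Quotient.mk (SameCycle.setoid g)) (t := Finset.univ)
      (fun _ _ => Finset.mem_coe.2 (Finset.mem_univ _)), Finset.sum_congr rfl fun q _ => hfib q]
  simp [mul_comm]

/-- Cutting a vertex of a plane graph in two leaves a plane graph. -/
theorem planar_of_split {E : Type} [Finite E] [DecidableEq E] {f g : Perm E} {x y : E}
    (hinv : ∀ e, g (g e) = e) (hg : ∀ e, g e ≠ e) (hne : x ≠ y) (h : f.SameCycle x y)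
    (hp : numCycles f + numCycles (f * g) = numCycles g + 2 * numOrbits f g) :
    numCycles (f * swap x y) + numCycles (f * swap x y * g) =
      numCycles g + 2 * numOrbits (f * swap x y) g := by
  have h1 := numCycles_add_numCycles_le_of_split (g := g) hne h
  have h2 := numCycles_add_numCycles_le (f * swap x y) g
  have h3 := two_mul_numCycles_of_involutive hinv hg
  omega

/-! ### Sums over states modulo a prime -/

/-- A sum of values that are constant along the cycles of a permutation of prime order reduces,
modulo that prime, to the sum over the fixed points. -/
theorem sum_sub_sum_fixed_mem_span {X R : Type*} [Fintype X] [DecidableEq X] [CommRing R]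
    {r : ℕ} (hr : r.Prime) (τ : Perm X) (hτ : τ ^ r = 1) (F : X → R) (hF : ∀ x, F (τ x) = F x) :
    ∑ x, F x - ∑ x with τ x = x, F x ∈ Ideal.span {(r : R)} := by
  classical
  have : Fact r.Prime := ⟨hr⟩
  have hcard : ∀ v : R, ∃ n : ℕ,
      (Finset.univ.filter fun x => F x = v).card =
        ((Finset.univ.filter fun x => τ x = x).filter fun x => F x = v).card + r * n := by
    intro v
    let τv : Perm {x // F x = v} := τ.subtypePerm fun x => by rw [hF]
    have hτv : τv ^ r ^ 1 = 1 := by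
      ext x
      simp [τv, subtypePerm_pow, hτ]
    have hmod := card_compl_support_modEq hτv
    have hle : τv.supportᶜ.card ≤ Fintype.card {x // F x = v} := Finset.card_le_univ _
    obtain ⟨n, hn⟩ := (Nat.modEq_iff_dvd' hle).1 hmod
    refine ⟨n, ?_⟩
    have h1 : Fintype.card {x // F x = v} = (Finset.univ.filter fun x => F x = v).card :=
      Fintype.card_subtype _
    have h2 : τv.supportᶜ.card =
        ((Finset.univ.filter fun x => τ x = x).filter fun x => F x = v).card := by
      rw [← Finset.card_map (Function.Embedding.subtype _)]
      congr 1
      ext x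
      simp [τv, Subtype.ext_iff, and_comm]
    omega
  choose n hn using hcard
  have hsum : ∀ s : Finset X, ∑ x ∈ s, F x =
      ∑ v ∈ Finset.univ.image F, ((s.filter fun x => F x = v).card : R) * v := by
    intro s
    rw [← Finset.sum_fiberwise_of_maps_to (t := Finset.univ.image F) (g := F)
      (fun x _ => Finset.mem_image_of_mem _ (Finset.mem_univ _))]
    refine Finset.sum_congr rfl fun v _ => ?_
    rw [Finset.sum_congr rfl fun x hx => (Finset.mem_filter.1 hx).2]
    simp
  rw [hsum, hsum, ← Finset.sum_sub_distrib]
  refine Ideal.sum_mem _ fun v _ => Ideal.mem_span_singleton.2 ⟨n v * v, ?_⟩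
  rw [hn]
  push_cast
  ring

/-- A linear relation between the values at the local states of each single coordinate yields
the product relation between the values at the global states. -/
theorem sum_prod_mul_eq_of_local {ι K R : Type*} [Fintype ι] [DecidableEq ι] [Fintype K]
    [CommRing R] (α β : K → R) (W : (ι → K) → R)
    (h : ∀ i σ, ∑ k, α k * W (Function.update σ i k) = ∑ k, β k * W (Function.update σ i k)) :
    ∑ σ, (∏ i, α (σ i)) * W σ = ∑ σ, (∏ i, β (σ i)) * W σ := by
  -- the weight at one coordinate may be exchanged if the others are arbitrary
  have step : ∀ (i : ι) (c : ι → K → R),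
      ∑ σ, α (σ i) * ((∏ j ∈ Finset.univ.erase i, c j (σ j)) * W σ) =
        ∑ σ, β (σ i) * ((∏ j ∈ Finset.univ.erase i, c j (σ j)) * W σ) := by
    intro i c
    have hsplit : ∀ γ : K → R,
        ∑ σ, γ (σ i) * ((∏ j ∈ Finset.univ.erase i, c j (σ j)) * W σ) =
          ∑ τ : {j // j ≠ i} → K, (∏ j : {j // j ≠ i}, c j (τ j)) *
            ∑ k, γ k * W ((Equiv.funSplitAt i K).symm (k, τ)) := by
      intro γ
      rw [← (Equiv.funSplitAt i K).symm.sum_comp, Fintype.sum_prod_type_right]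
      refine Finset.sum_congr rfl fun τ _ => ?_
      rw [Finset.mul_sum]
      refine Finset.sum_congr rfl fun k _ => ?_
      have hprod : ∏ j ∈ Finset.univ.erase i, c j ((Equiv.funSplitAt i K).symm (k, τ) j) =
          ∏ j : {j // j ≠ i}, c j (τ j) := by
        rw [Finset.prod_subtype (p := fun j => j ≠ i) _ (by simp)]
        refine Finset.prod_congr rfl fun j _ => ?_
        simp [Equiv.funSplitAt, j.2]
      have hval : (Equiv.funSplitAt i K).symm (k, τ) i = k := by simp [Equiv.funSplitAt]
      rw [hprod, hval]
      ring
    rw [hsplit, hsplit]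
    refine Finset.sum_congr rfl fun τ _ => ?_
    congr 1
    rcases isEmpty_or_nonempty K with hK | ⟨⟨k₀⟩⟩
    · simp
    · have hupd : ∀ k, (Equiv.funSplitAt i K).symm (k, τ) =
          Function.update ((Equiv.funSplitAt i K).symm (k₀, τ)) i k := by
        intro k
        ext j
        by_cases hj : j = i
        · subst hj; simp [Equiv.funSplitAt]
        · simp [Equiv.funSplitAt, hj]
      exact (Finset.sum_congr rfl fun k _ => congrArg (fun w => α k * W w) (hupd k)).trans
        ((h i _).trans
          (Finset.sum_congr rfl fun k _ => congrArg (fun w => β k * W w) (hupd k).symm))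
  have hind : ∀ s : Finset ι,
      ∑ σ, (∏ i, α (σ i)) * W σ = ∑ σ, (∏ i, (if i ∈ s then β else α) (σ i)) * W σ := by
    intro s
    induction s using Finset.induction_on with
    | empty => simp
    | insert i s hi ih =>
      rw [ih]
      have := step i fun j => if j ∈ s then β else α
      have h1 : ∀ σ : ι → K, (∏ j, (if j ∈ s then β else α) (σ j)) * W σ =
          α (σ i) * ((∏ j ∈ Finset.univ.erase i, (if j ∈ s then β else α) (σ j)) * W σ) := by
        intro σ
        rw [← Finset.mul_prod_erase _ _ (Finset.mem_univ i), if_neg hi, mul_assoc]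
      have h2 : ∀ σ : ι → K, (∏ j, (if j ∈ insert i s then β else α) (σ j)) * W σ =
          β (σ i) * ((∏ j ∈ Finset.univ.erase i, (if j ∈ s then β else α) (σ j)) * W σ) := by
        intro σ
        rw [← Finset.mul_prod_erase _ _ (Finset.mem_univ i), if_pos (Finset.mem_insert_self _ _),
          mul_assoc]
        congr 2
        refine Finset.prod_congr rfl fun j hj => ?_
        simp [Finset.mem_insert, Finset.ne_of_mem_erase hj]
      rw [Finset.sum_congr rfl fun σ _ => h1 σ, this]
      exact Finset.sum_congr rfl fun σ _ => (h2 σ).symm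
  simpa using hind Finset.univ

/-- The periodic skein relation: a local relation, applied at all `r` places of an orbit, holds
modulo `r` with the `r`-th powers of its coefficients and only the constant states. -/
theorem sum_pow_mul_sub_mem_span {K R : Type*} [Fintype K] [CommRing R] {r : ℕ} (hr : r.Prime)
    (α β : K → R) (W : (ZMod r → K) → R)
    (hshift : ∀ σ, W (fun i => σ (i + 1)) = W σ)
    (h : ∀ i σ, ∑ k, α k * W (Function.update σ i k) = ∑ k, β k * W (Function.update σ i k)) :
    ∑ k, α k ^ r * W (fun _ => k) - ∑ k, β k ^ r * W (fun _ => k) ∈ Ideal.span {(r : R)} := by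
  classical
  have : Fact r.Prime := ⟨hr⟩
  let τ : Perm (ZMod r → K) := (Equiv.addRight (1 : ZMod r)).symm.arrowCongr (Equiv.refl K)
  have hτ : ∀ σ i, τ σ i = σ (i + 1) := fun σ i => rfl
  have hpow : ∀ (n : ℕ) σ i, (τ ^ n) σ i = σ (i + n) := by
    intro n
    induction n with
    | zero => simp
    | succ n ih =>
      intro σ i
      rw [pow_succ, mul_apply, ih, hτ]
      push_cast
      ring_nf
  have hτr : τ ^ r = 1 := by
    ext σ i
    simp [hpow]
  have hfix : (Finset.univ.filter fun σ => τ σ = σ) = Finset.univ.image fun k (_ : ZMod r) => k := by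
    ext σ
    simp only [Finset.mem_filter, Finset.mem_univ, true_and, Finset.mem_image]
    constructor
    · intro hσ
      have hσn : ∀ n : ℕ, σ n = σ 0 := by
        intro n
        induction n with
        | zero => simp
        | succ n ih =>
          rw [← ih]
          push_cast
          exact congrFun hσ n
      refine ⟨σ 0, funext fun i => ?_⟩
      have := hσn i.val
      rw [ZMod.natCast_zmod_val] at this
      exact this.symm
    · rintro ⟨k, rfl⟩
      rfl
  have key : ∀ γ : K → R, ∑ σ, (∏ i, γ (σ i)) * W σ - ∑ k, γ k ^ r * W (fun _ => k)
      ∈ Ideal.span {(r : R)} := by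
    intro γ
    have := sum_sub_sum_fixed_mem_span hr τ hτr (fun σ => (∏ i, γ (σ i)) * W σ) (by
      intro σ
      have h1 : W (τ σ) = W σ := hshift σ
      have h2 : ∏ i, γ (τ σ i) = ∏ i, γ (σ i) :=
        Equiv.prod_comp (Equiv.addRight (1 : ZMod r)) fun i => γ (σ i)
      simp only [h1, h2])
    rw [hfix, Finset.sum_image fun a _ b _ hab => congrFun hab 0] at this
    simpa [ZMod.card] using this
  have h1 := key α
  rw [sum_prod_mul_eq_of_local α β W h] at h1
  have := sub_mem (key β) h1
  simpa using this

/-! ### Resolutions of the crossings of a diagram -/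

/-- What is done to a crossing: it is kept, switched, or smoothed in one of the two ways. -/
inductive CrossingState
  | keep
  | switch
  | zero
  | inf

namespace LinkDiagram

variable {E E' : Type}

section vertex

variable (D : LinkDiagram E)

theorem next_symm_eq (e : E) : D.next.symm e = D.next (D.next (D.next e)) := by
  rw [Equiv.symm_apply_eq, D.next_four]

theorem isCrossing_next_iff (e : E) : D.IsCrossing (D.next e) ↔ D.IsCrossing e := by
  simp [IsCrossing]

theorem mem_vertex_self (d : E) : d ∈ D.vertex d := SameCycle.refl _ _

theorem next_mem_vertex_iff {d e : E} : D.next e ∈ D.vertex d ↔ e ∈ D.vertex d :=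
  sameCycle_apply_right

theorem mem_vertex_iff {d e : E} : e ∈ D.vertex d ↔
    e = d ∨ e = D.next d ∨ e = D.next (D.next d) ∨ e = D.next (D.next (D.next d)) := by
  constructor
  · intro h
    have := D.finite
    obtain ⟨n, -, rfl⟩ := SameCycle.exists_pow_eq' h
    induction n with
    | zero => simp
    | succ n ih =>
      rw [pow_succ', mul_apply]
      rcases ih ⟨n, by simp⟩ with h | h | h | h <;> simp [h, D.next_four]
  · rintro (rfl | rfl | rfl | rfl) <;> simp [next_mem_vertex_iff, mem_vertex_self]

end vertex

/-- `c` assigns a state to every vertex of `D`, and only crossings are changed. The darts in `M`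
are, at every crossing, the two opposite darts that are joined to their counterclockwise
neighbours by the smoothing `zero`; the smoothing `inf` joins them to their clockwise
neighbours. -/
structure IsColoring (D : LinkDiagram E) (M : Set E) (c : E → CrossingState) : Prop where
  next : ∀ e, c (D.next e) = c e
  crossing : ∀ e, c e ≠ .keep → D.IsCrossing e
  alternating : ∀ e, D.IsCrossing e → (D.next e ∈ M ↔ e ∉ M)

variable {D : LinkDiagram E} {M : Set E} {c c₁ c₂ : E → CrossingState}

namespace IsColoring

theorem next_symm (h : D.IsColoring M c) (e : E) : c (D.next.symm e) = c e := by
  rw [← h.next, apply_symm_apply]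

theorem next_mem_iff (h : D.IsColoring M c) {e : E} (he : c e ≠ .keep) :
    D.next e ∈ M ↔ e ∉ M :=
  h.alternating e (h.crossing e he)

theorem next_symm_mem_iff (h : D.IsColoring M c) {e : E} (he : c e ≠ .keep) :
    D.next.symm e ∈ M ↔ e ∉ M := by
  have := h.next_mem_iff (e := D.next.symm e) (by rwa [h.next_symm])
  rw [apply_symm_apply] at this
  tauto

open Classical in
/-- The counterclockwise order of the darts after the crossings have been smoothed
as prescribed by `c`. -/
noncomputable def resolveNext (h : D.IsColoring M c) : Perm E where
  toFun e := if c e = .zero ∧ e ∉ M ∨ c e = .inf ∧ e ∈ M then D.next.symm e else D.next e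
  invFun e := if c e = .zero ∧ e ∈ M ∨ c e = .inf ∧ e ∉ M then D.next e else D.next.symm e
  left_inv e := by
    have h1 := h.next e
    have h2 := h.next_symm e
    rcases hc : c e with _ | _ | _ | _ <;> rw [hc] at h1 h2 <;> by_cases he : e ∈ M
    all_goals
      first
      | simp [*]; done
      | have h3 := h.next_mem_iff (e := e) (by simp [hc])
        have h4 := h.next_symm_mem_iff (e := e) (by simp [hc])
        simp [*]
  right_inv e := by
    have h1 := h.next e
    have h2 := h.next_symm e
    rcases hc : c e with _ | _ | _ | _ <;> rw [hc] at h1 h2 <;> by_cases he : e ∈ M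
    all_goals
      first
      | simp [*]; done
      | have h3 := h.next_mem_iff (e := e) (by simp [hc])
        have h4 := h.next_symm_mem_iff (e := e) (by simp [hc])
        simp [*]

theorem resolveNext_of_ne (h : D.IsColoring M c) {e : E} (h₀ : c e ≠ .zero) (h₁ : c e ≠ .inf) :
    h.resolveNext e = D.next e := by
  simp [resolveNext, h₀, h₁]

theorem resolveNext_zero_mem (h : D.IsColoring M c) {e : E} (hc : c e = .zero) (he : e ∈ M) :
    h.resolveNext e = D.next e := by
  simp [resolveNext, hc, he]

theorem resolveNext_zero_notMem (h : D.IsColoring M c) {e : E} (hc : c e = .zero) (he : e ∉ M) :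
    h.resolveNext e = D.next.symm e := by
  simp [resolveNext, hc, he]

theorem resolveNext_inf_mem (h : D.IsColoring M c) {e : E} (hc : c e = .inf) (he : e ∈ M) :
    h.resolveNext e = D.next.symm e := by
  simp [resolveNext, hc, he]

theorem resolveNext_inf_notMem (h : D.IsColoring M c) {e : E} (hc : c e = .inf) (he : e ∉ M) :
    h.resolveNext e = D.next e := by
  simp [resolveNext, hc, he]

theorem resolveNext_congr (h₁ : D.IsColoring M c₁) (h₂ : D.IsColoring M c₂) {e : E}
    (hc : c₂ e = c₁ e) : h₂.resolveNext e = h₁.resolveNext e := by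
  simp only [resolveNext, coe_fn_mk]
  rw [hc]

theorem resolveNext_resolveNext (h : D.IsColoring M c) {e : E}
    (hc : c e = .zero ∨ c e = .inf) : h.resolveNext (h.resolveNext e) = e := by
  have hne : c e ≠ .keep := by rcases hc with hc | hc <;> simp [hc]
  have h3 := h.next_mem_iff hne
  have h4 := h.next_symm_mem_iff hne
  have h1 := h.next e
  have h2 := h.next_symm e
  rcases hc with hc | hc <;> rw [hc] at h1 h2 <;> by_cases he : e ∈ M
  · rw [h.resolveNext_zero_mem hc he, h.resolveNext_zero_notMem h1 (by tauto), symm_apply_apply]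
  · rw [h.resolveNext_zero_notMem hc he, h.resolveNext_zero_mem h2 (by tauto), apply_symm_apply]
  · rw [h.resolveNext_inf_mem hc he, h.resolveNext_inf_notMem h2 (by tauto), apply_symm_apply]
  · rw [h.resolveNext_inf_notMem hc he, h.resolveNext_inf_mem h1 (by tauto), symm_apply_apply]

theorem resolveNext_resolveNext_of_ne (h : D.IsColoring M c) {e : E}
    (h₀ : c e ≠ .zero) (h₁ : c e ≠ .inf) :
    h.resolveNext (h.resolveNext e) = D.next (D.next e) := by
  rw [h.resolveNext_of_ne h₀ h₁, h.resolveNext_of_ne (by rwa [h.next]) (by rwa [h.next])]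

open Classical in
/-- A vertex may be given another state if it is a crossing. -/
theorem update (h : D.IsColoring M c) (d : E) (hd : D.IsCrossing d) (k : CrossingState) :
    D.IsColoring M fun e => if e ∈ D.vertex d then k else c e where
  next e := by simp only [D.next_mem_vertex_iff, h.next]
  crossing e he := by
    by_cases hev : e ∈ D.vertex d
    · rw [mem_vertex_iff] at hev
      rcases hev with rfl | rfl | rfl | rfl <;> simpa [isCrossing_next_iff] using hd
    · rw [if_neg hev] at he
      exact h.crossing e he
  alternating := h.alternating

open Classical in
/-- Smoothing a crossing amounts to cutting its vertex in two. -/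
theorem resolveNext_eq_mul_swap (h : D.IsColoring M c) {d : E}
    (hd : c d = .zero ∧ d ∈ M ∨ c d = .inf ∧ d ∉ M) (hX : D.IsCrossing d) :
    h.resolveNext =
      (h.update d hX .keep).resolveNext * swap (D.next d) (D.next (D.next (D.next d))) := by
  have hne : c d ≠ .keep := by rcases hd with ⟨hc, -⟩ | ⟨hc, -⟩ <;> simp [hc]
  have hnn : D.next (D.next d) ≠ d := hX
  have h4 := D.next_four d
  have h1 : D.next d ∈ M ↔ d ∉ M := h.next_mem_iff hne
  have h2 : D.next (D.next d) ∈ M ↔ D.next d ∉ M := h.next_mem_iff (by rwa [h.next])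
  have h3 : D.next (D.next (D.next d)) ∈ M ↔ D.next (D.next d) ∉ M :=
    h.next_mem_iff (by rwa [h.next, h.next])
  have hself : ∀ e, D.next e ≠ e := D.next_ne
  have hself' : ∀ e, e ≠ D.next e := fun e => (D.next_ne e).symm
  have hv : ∀ e ∈ D.vertex d, (h.update d hX .keep).resolveNext e = D.next e := fun e he =>
    (h.update d hX .keep).resolveNext_of_ne (by simp [he]) (by simp [he])
  ext e
  rw [mul_apply]
  by_cases he : e ∈ D.vertex d
  · have hd0 := D.mem_vertex_self d
    have hd1 := D.next_mem_vertex_iff.2 hd0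
    have hd2 := D.next_mem_vertex_iff.2 hd1
    have hd3 := D.next_mem_vertex_iff.2 hd2
    rcases D.mem_vertex_iff.1 he with rfl | rfl | rfl | rfl
    · have h5 : e ≠ D.next (D.next (D.next e)) := fun h => hself e (by
        conv_lhs => rw [h]
        exact h4)
      rw [swap_apply_of_ne_of_ne (hself' e) h5, hv _ hd0]
      rcases hd with ⟨hc, hm⟩ | ⟨hc, hm⟩
      · exact h.resolveNext_zero_mem hc hm
      · exact h.resolveNext_inf_notMem hc hm
    · rw [swap_apply_left, hv _ hd3, h4]
      rcases hd with ⟨hc, hm⟩ | ⟨hc, hm⟩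
      · rw [h.resolveNext_zero_notMem (by rw [h.next, hc]) (by tauto), symm_apply_apply]
      · rw [h.resolveNext_inf_mem (by rw [h.next, hc]) (by tauto), symm_apply_apply]
    · rw [swap_apply_of_ne_of_ne (hself _) (hself' _), hv _ hd2]
      rcases hd with ⟨hc, hm⟩ | ⟨hc, hm⟩
      · exact h.resolveNext_zero_mem (by rw [h.next, h.next, hc]) (by tauto)
      · exact h.resolveNext_inf_notMem (by rw [h.next, h.next, hc]) (by tauto)
    · rw [swap_apply_right, hv _ hd1]
      rcases hd with ⟨hc, hm⟩ | ⟨hc, hm⟩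
      · rw [h.resolveNext_zero_notMem (by rw [h.next, h.next, h.next, hc]) (by tauto),
          symm_apply_apply]
      · rw [h.resolveNext_inf_mem (by rw [h.next, h.next, h.next, hc]) (by tauto),
          symm_apply_apply]
  · have hx : e ≠ D.next d := fun h => he (D.mem_vertex_iff.2 (by simp [h]))
    have hy : e ≠ D.next (D.next (D.next d)) := fun h => he (D.mem_vertex_iff.2 (by simp [h]))
    rw [swap_apply_of_ne_of_ne hx hy]
    simp [resolveNext, he]

/-- Resolving the crossings of a plane diagram yields a plane diagram. -/
theorem planar (h : D.IsColoring M c) :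
    numCycles h.resolveNext + numCycles (h.resolveNext * D.edge) =
      numCycles D.edge + 2 * numOrbits h.resolveNext D.edge := by
  classical
  have := D.finite
  induction hn : {e | c e = .zero ∨ c e = .inf}.ncard using Nat.strong_induction_on
    generalizing c with
  | _ n ih =>
    by_cases hex : ∃ d, c d = .zero ∧ d ∈ M ∨ c d = .inf ∧ d ∉ M
    · obtain ⟨d, hd⟩ := hex
      have hne : c d ≠ .keep := by rcases hd with ⟨hc, -⟩ | ⟨hc, -⟩ <;> simp [hc]
      have hX := h.crossing d hne
      have hd0 := D.mem_vertex_self d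
      have hd1 := D.next_mem_vertex_iff.2 hd0
      have hd2 := D.next_mem_vertex_iff.2 hd1
      have hlt : {e | (if e ∈ D.vertex d then CrossingState.keep else c e) = .zero ∨
          (if e ∈ D.vertex d then CrossingState.keep else c e) = .inf}.ncard < n := by
        rw [← hn]
        refine Set.ncard_lt_ncard ?_ (Set.toFinite _)
        refine (Set.ssubset_iff_of_subset ?_).2 ⟨d, by tauto, by simp [hd0]⟩
        intro e he
        by_cases hev : e ∈ D.vertex d
        · simp [hev] at he
        · simpa [hev] using he
      have h' := h.update d hX .keep
      rw [h.resolveNext_eq_mul_swap hd hX]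
      refine planar_of_split D.edge_edge D.edge_ne ?_ ⟨2, ?_⟩ (ih _ hlt h' rfl)
      · intro h0
        exact hX (D.next.injective h0).symm
      · rw [zpow_two, mul_apply,
          h'.resolveNext_resolveNext_of_ne (by simp [hd1]) (by simp [hd1])]
    · have hall : ∀ e, c e ≠ .zero ∧ c e ≠ .inf := by
        intro e
        by_contra! hs
        have hs' : c e = .zero ∨ c e = .inf := by tauto
        have hne : c e ≠ .keep := by rcases hs' with hs' | hs' <;> simp [hs']
        have hmem := h.next_mem_iff hne
        have hcn := h.next e
        apply hex
        by_cases he : e ∈ M <;> rcases hs' with hs' | hs'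
        · exact ⟨e, by tauto⟩
        · exact ⟨D.next e, by rw [hcn]; tauto⟩
        · exact ⟨D.next e, by rw [hcn]; tauto⟩
        · exact ⟨e, by tauto⟩
      have : h.resolveNext = D.next := by
        ext e
        exact h.resolveNext_of_ne (hall e).1 (hall e).2
      rw [this]
      exact D.planar

end IsColoring

/-- The diagram obtained from `D` by changing its crossings as prescribed by `c`. -/
noncomputable def resolve (D : LinkDiagram E) (h : D.IsColoring M c) : LinkDiagram E where
  finite := D.finite
  nonempty := D.nonempty
  edge := D.edge
  edge_edge := D.edge_edge
  edge_ne := D.edge_ne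
  next := h.resolveNext
  next_ne e := by
    by_cases hs : c e = .zero ∧ e ∉ M ∨ c e = .inf ∧ e ∈ M
    · simp only [IsColoring.resolveNext, coe_fn_mk, hs, if_true, ne_eq, symm_apply_eq]
      exact (D.next_ne e).symm
    · simp only [IsColoring.resolveNext, coe_fn_mk, hs, if_false, ne_eq]
      exact D.next_ne e
  next_four e := by
    by_cases hs : c e = .zero ∨ c e = .inf
    · rw [h.resolveNext_resolveNext hs, h.resolveNext_resolveNext hs]
    · push Not at hs
      rw [h.resolveNext_resolveNext_of_ne hs.1 hs.2, h.resolveNext_resolveNext_of_ne, D.next_four]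
        <;> rw [h.next, h.next]
      exacts [hs.1, hs.2]
  upper e := c e = .keep ∧ D.upper e ∨ c e = .switch ∧ ¬ D.upper e
  upper_crossing e he := by
    have hs : ¬ (c e = .zero ∨ c e = .inf) := fun hs => he (h.resolveNext_resolveNext hs)
    push Not at hs
    rw [h.resolveNext_resolveNext_of_ne hs.1 hs.2] at he
    have := D.upper_crossing e he
    rw [h.resolveNext_of_ne hs.1 hs.2, h.next]
    rcases hc : c e with _ | _ | _ | _ <;> simp_all
  upper_marked e he := by
    by_cases hs : c e = .zero ∨ c e = .inf
    · rcases hs with hs | hs <;> simp [hs]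
    · push Not at hs
      rw [h.resolveNext_resolveNext_of_ne hs.1 hs.2] at he
      have h1 := D.upper_marked e he
      have h2 : c e ≠ .switch := fun hc => h.crossing e (by simp [hc]) he
      simp [h1, h2]
  planar := h.planar

/-! ### Skein relations and isomorphisms between resolutions -/

section resolve

theorem resolve_next_of_ne (h : D.IsColoring M c) {e : E} (h₀ : c e ≠ .zero) (h₁ : c e ≠ .inf) :
    (D.resolve h).next e = D.next e :=
  h.resolveNext_of_ne h₀ h₁

theorem resolve_upper_of_keep (h : D.IsColoring M c) {e : E} (hc : c e = .keep) :
    (D.resolve h).upper e ↔ D.upper e := by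
  simp [resolve, hc]

theorem resolve_isCrossing_iff_of_keep (h : D.IsColoring M c) {e : E} (hc : c e = .keep) :
    (D.resolve h).IsCrossing e ↔ D.IsCrossing e := by
  have := h.resolveNext_resolveNext_of_ne (e := e) (by simp [hc]) (by simp [hc])
  simp only [IsCrossing, resolve, this]

theorem resolve_vertex_of_keep (h : D.IsColoring M c) {d : E} (hc : c d = .keep) :
    (D.resolve h).vertex d = D.vertex d := by
  have h1 : ∀ e, c e = .keep → (D.resolve h).next e = D.next e := fun e he =>
    h.resolveNext_of_ne (by simp [he]) (by simp [he])
  ext e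
  rw [mem_vertex_iff, mem_vertex_iff, h1 d hc, h1 (D.next d) (by rw [h.next, hc]),
    h1 (D.next (D.next d)) (by rw [h.next, h.next, hc])]

variable {V : Set E} (h₁ : D.IsColoring M c₁) (h₂ : D.IsColoring M c₂)
  (hout : ∀ e ∉ V, c₂ e = c₁ e) (hkeep : ∀ e ∈ V, c₁ e = .keep)
include hout hkeep

theorem resolve_isSwitch (hin : ∀ e ∈ V, c₂ e = .switch) :
    (D.resolve h₁).IsSwitch (D.resolve h₂) V where
  edge := rfl
  next := by
    ext e
    change h₂.resolveNext e = h₁.resolveNext e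
    by_cases he : e ∈ V
    · rw [h₁.resolveNext_of_ne (by simp [hkeep e he]) (by simp [hkeep e he]),
        h₂.resolveNext_of_ne (by simp [hin e he]) (by simp [hin e he])]
    · exact IsColoring.resolveNext_congr h₁ h₂ (hout e he)
  upper_inside e he := by simp [resolve, hkeep e he, hin e he]
  upper_outside e he := by simp [resolve, hout e he]

theorem resolve_isSmoothing_zero (hin : ∀ e ∈ V, c₂ e = .zero) :
    (D.resolve h₁).IsSmoothing (D.resolve h₂) V M where
  edge := rfl
  next_mem e he hM :=
    (h₂.resolveNext_zero_mem (hin e he) hM).trans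
      (h₁.resolveNext_of_ne (by simp [hkeep e he]) (by simp [hkeep e he])).symm
  next_notMem e he hM := by
    change h₂.resolveNext e = h₁.resolveNext.symm e
    rw [h₂.resolveNext_zero_notMem (hin e he) hM, eq_symm_apply, h₁.resolveNext_of_ne,
      apply_symm_apply] <;> simp [h₁.next_symm, hkeep e he]
  next_outside e he := IsColoring.resolveNext_congr h₁ h₂ (hout e he)
  upper_outside e he := by simp [resolve, hout e he]

theorem resolve_isSmoothing_inf (hin : ∀ e ∈ V, c₂ e = .inf) :
    (D.resolve h₁).IsSmoothing (D.resolve h₂) V Mᶜ where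
  edge := rfl
  next_mem e he hM :=
    (h₂.resolveNext_inf_notMem (hin e he) hM).trans
      (h₁.resolveNext_of_ne (by simp [hkeep e he]) (by simp [hkeep e he])).symm
  next_notMem e he hM := by
    change h₂.resolveNext e = h₁.resolveNext.symm e
    rw [h₂.resolveNext_inf_mem (hin e he) (not_not.1 hM), eq_symm_apply, h₁.resolveNext_of_ne,
      apply_symm_apply] <;> simp [h₁.next_symm, hkeep e he]
  next_outside e he := IsColoring.resolveNext_congr h₁ h₂ (hout e he)
  upper_outside e he := by simp [resolve, hout e he]

end resolve

theorem IsSmoothing.congr {D' : LinkDiagram E} {S M' : Set E} (h : D.IsSmoothing D' S M)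
    (hM : ∀ e ∈ S, (e ∈ M' ↔ e ∈ M)) : D.IsSmoothing D' S M' where
  edge := h.edge
  next_mem e he hm := h.next_mem e he ((hM e he).1 hm)
  next_notMem e he hm := h.next_notMem e he fun hm' => hm ((hM e he).2 hm')
  next_outside := h.next_outside
  upper_outside := h.upper_outside

/-- An automorphism of `D` that respects the choice of the smoothings maps a resolution
of `D` to the resolution with the transported states. -/
theorem IsIso.resolve {φ : Perm E} (hφ : D.IsIso D φ) (h₁ : D.IsColoring M c₁)
    (h₂ : D.IsColoring M c₂) (hc : ∀ e, c₂ (φ e) = c₁ e) (hM : ∀ e, φ e ∈ M ↔ e ∈ M) :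
    (D.resolve h₁).IsIso (D.resolve h₂) φ where
  edge := hφ.edge
  next e := by
    have hsymm : D.next.symm (φ e) = φ (D.next.symm e) := by
      rw [symm_apply_eq, hφ.next, apply_symm_apply]
    by_cases hs : c₁ e = .zero ∧ e ∉ M ∨ c₁ e = .inf ∧ e ∈ M
    · simp [LinkDiagram.resolve, IsColoring.resolveNext, hc, hM, hs, hsymm]
    · simp [LinkDiagram.resolve, IsColoring.resolveNext, hc, hM, hs, hφ.next]
  upper e := by simp [LinkDiagram.resolve, hc, hφ.upper]

section ofState

variable {D' : LinkDiagram E} {S : Set E} (h : D.IsColoring M c) (hout : ∀ e ∉ S, c e = .keep)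
include hout

theorem isIso_resolve_keep (hin : ∀ e ∈ S, c e = .keep) :
    D.IsIso (D.resolve h) (Equiv.refl E) := by
  have hall : ∀ e, c e = .keep := fun e => by
    by_cases he : e ∈ S
    exacts [hin e he, hout e he]
  exact ⟨fun e => rfl, fun e => h.resolveNext_of_ne (by simp [hall]) (by simp [hall]),
    fun e => resolve_upper_of_keep h (hall e)⟩

theorem IsSwitch.isIso_resolve (hD : D.IsSwitch D' S) (hin : ∀ e ∈ S, c e = .switch) :
    D'.IsIso (D.resolve h) (Equiv.refl E) where
  edge e := by simp [resolve, hD.edge]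
  next e := by
    have hs : c e ≠ .zero ∧ c e ≠ .inf := by
      by_cases he : e ∈ S
      · simp [hin e he]
      · simp [hout e he]
    simp [resolve_next_of_ne h hs.1 hs.2, hD.next]
  upper e := by
    by_cases he : e ∈ S
    · simp [resolve, hin e he, hD.upper_inside e he]
    · simp [resolve, hout e he, hD.upper_outside e he]

theorem isIso_resolve_of_smoothing {N : Set E} (hD : D.IsSmoothing D' S N)
    (hin : ∀ e ∈ S, c e = .zero ∨ c e = .inf) (hnext : ∀ e ∈ S, D'.next e = h.resolveNext e) :
    D'.IsIso (D.resolve h) (Equiv.refl E) := by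
  have hall : ∀ e, D'.next e = h.resolveNext e := by
    intro e
    by_cases he : e ∈ S
    · exact hnext e he
    · rw [hD.next_outside e he, h.resolveNext_of_ne] <;> simp [hout e he]
  refine ⟨fun e => by simp [resolve, hD.edge], fun e => (hall e).symm, fun e => ?_⟩
  by_cases he : e ∈ S
  · -- the darts in `S` start at marked points after the smoothing
    have h1 := D'.upper_marked e (by rw [hall, hall, h.resolveNext_resolveNext (hin e he)])
    rcases hin e he with hc | hc <;> simp [resolve, hc, h1]
  · simp [resolve, hout e he, hD.upper_outside e he]

theorem IsSmoothing.isIso_resolve_zero (hD : D.IsSmoothing D' S M) (hin : ∀ e ∈ S, c e = .zero) :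
    D'.IsIso (D.resolve h) (Equiv.refl E) := by
  refine isIso_resolve_of_smoothing h hout hD (fun e he => Or.inl (hin e he)) fun e he => ?_
  by_cases hm : e ∈ M
  · rw [hD.next_mem e he hm, h.resolveNext_zero_mem (hin e he) hm]
  · rw [hD.next_notMem e he hm, h.resolveNext_zero_notMem (hin e he) hm]

theorem IsSmoothing.isIso_resolve_inf (hD : D.IsSmoothing D' S Mᶜ) (hin : ∀ e ∈ S, c e = .inf) :
    D'.IsIso (D.resolve h) (Equiv.refl E) := by
  refine isIso_resolve_of_smoothing h hout hD (fun e he => Or.inr (hin e he)) fun e he => ?_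
  by_cases hm : e ∈ M
  · rw [hD.next_notMem e he (not_not.2 hm), h.resolveNext_inf_mem (hin e he) hm]
  · rw [hD.next_mem e he hm, h.resolveNext_inf_notMem (hin e he) hm]

end ofState

end LinkDiagram

/-! ### The orbit of a crossing -/

namespace LinkDiagram

variable {E : Type} {D : LinkDiagram E}

theorem IsIso.apply_mem_vertex_iff {φ : Perm E} (hφ : D.IsIso D φ) {d e : E} :
    φ e ∈ D.vertex (φ d) ↔ e ∈ D.vertex d := by
  simp [mem_vertex_iff, hφ.next]

/-- The darts at the crossing number `i` of the orbit of the crossing at which `d` starts. -/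
def orbitVertex (D : LinkDiagram E) {r : ℕ} (φ : Perm E) (d : E) (i : ZMod r) : Set E :=
  D.vertex ((φ ^ i.val) d)

open Classical in
/-- The states of all the vertices when those of the crossings in the orbit of `d` are
prescribed by `σ`. -/
noncomputable def orbitColor (D : LinkDiagram E) {r : ℕ} (φ : Perm E) (d : E)
    (σ : ZMod r → CrossingState) (e : E) : CrossingState :=
  if h : ∃ i, e ∈ D.orbitVertex φ d i then σ h.choose else .keep

end LinkDiagram

namespace IsPeriodic

open LinkDiagram

variable {E : Type} {D : LinkDiagram E} {r : ℕ} [Fact r.Prime] {φ : Perm E} {d e : E}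

theorem pow_val_natCast (hφ : IsPeriodic D r φ) (n : ℕ) : φ ^ (n : ZMod r).val = φ ^ n := by
  rw [ZMod.val_natCast, ← pow_eq_pow_mod n hφ.pow_eq_one]

theorem pow_val_add (hφ : IsPeriodic D r φ) (i j : ZMod r) :
    φ ^ (i + j).val = φ ^ i.val * φ ^ j.val := by
  rw [ZMod.val_add, ← pow_eq_pow_mod _ hφ.pow_eq_one, pow_add]

theorem pow_val_one (hφ : IsPeriodic D r φ) : φ ^ (1 : ZMod r).val = φ := by
  simpa using hφ.pow_val_natCast 1

omit [Fact r.Prime] in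
theorem pow_apply_mem_vertex_iff (hφ : IsPeriodic D r φ) (n : ℕ) :
    (φ ^ n) e ∈ D.vertex ((φ ^ n) d) ↔ e ∈ D.vertex d := by
  induction n with
  | zero => simp
  | succ n ih => rw [pow_succ', mul_apply, mul_apply, hφ.symmetry.apply_mem_vertex_iff, ih]

theorem mem_orbit_iff (hφ : IsPeriodic D r φ) :
    e ∈ D.orbit φ d ↔ ∃ i : ZMod r, e ∈ D.orbitVertex φ d i := by
  constructor
  · rintro ⟨n, hn⟩
    refine ⟨n, ?_⟩
    rw [orbitVertex, hφ.pow_val_natCast]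
    exact hn
  · rintro ⟨i, hi⟩
    exact ⟨i.val, hi⟩

theorem apply_mem_orbitVertex_iff (hφ : IsPeriodic D r φ) {i : ZMod r} :
    φ e ∈ D.orbitVertex φ d (i + 1) ↔ e ∈ D.orbitVertex φ d i := by
  rw [orbitVertex, add_comm, hφ.pow_val_add, hφ.pow_val_one, mul_apply,
    hφ.symmetry.apply_mem_vertex_iff, orbitVertex]

/-- Since `r` is prime, the crossings in the orbit are different as soon as the first two are. -/
theorem eq_of_mem_orbitVertex (hφ : IsPeriodic D r φ) (hd : φ d ∉ D.vertex d) {i j : ZMod r}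
    (hi : e ∈ D.orbitVertex φ d i) (hj : e ∈ D.orbitVertex φ d j) : i = j := by
  by_contra hij
  have hm : (φ ^ (j - i).val) d ∈ D.vertex d := by
    rw [← hφ.pow_apply_mem_vertex_iff i.val, ← mul_apply, ← hφ.pow_val_add, add_sub_cancel]
    exact SameCycle.trans hi (SameCycle.symm hj)
  have hmul : ∀ n : ℕ, (φ ^ (n * (j - i)).val) d ∈ D.vertex d := by
    intro n
    induction n with
    | zero => simpa using D.mem_vertex_self d
    | succ n ih =>
      rw [Nat.cast_succ, add_mul, one_mul, add_comm, hφ.pow_val_add, mul_apply]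
      exact SameCycle.trans hm ((hφ.pow_apply_mem_vertex_iff _).2 ih)
  apply hd
  have := hmul ((j - i)⁻¹).val
  rwa [ZMod.natCast_zmod_val, inv_mul_cancel₀ (sub_ne_zero.2 (Ne.symm hij)),
    hφ.pow_val_one] at this

theorem orbitColor_of_mem (hφ : IsPeriodic D r φ) (hd : φ d ∉ D.vertex d)
    (σ : ZMod r → CrossingState) {i : ZMod r} (he : e ∈ D.orbitVertex φ d i) :
    D.orbitColor φ d σ e = σ i := by
  have h : ∃ i : ZMod r, e ∈ D.orbitVertex φ d i := ⟨i, he⟩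
  rw [orbitColor, dif_pos h, hφ.eq_of_mem_orbitVertex hd h.choose_spec he]

theorem orbitColor_of_notMem (hφ : IsPeriodic D r φ) (σ : ZMod r → CrossingState)
    (he : e ∉ D.orbit φ d) : D.orbitColor φ d σ e = .keep := by
  rw [hφ.mem_orbit_iff] at he
  rw [orbitColor, dif_neg he]

theorem orbitColor_const (hφ : IsPeriodic D r φ) (k : CrossingState) (he : e ∈ D.orbit φ d) :
    D.orbitColor φ d (fun _ : ZMod r => k) e = k := by
  rw [hφ.mem_orbit_iff] at he
  rw [orbitColor, dif_pos he]

theorem orbitColor_update_of_notMem (hφ : IsPeriodic D r φ) (hd : φ d ∉ D.vertex d)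
    (σ : ZMod r → CrossingState) (i : ZMod r) (k : CrossingState)
    (he : e ∉ D.orbitVertex φ d i) :
    D.orbitColor φ d (Function.update σ i k) e = D.orbitColor φ d σ e := by
  by_cases h : ∃ j : ZMod r, e ∈ D.orbitVertex φ d j
  · obtain ⟨j, hj⟩ := h
    have hji : j ≠ i := fun h => he (h ▸ hj)
    rw [hφ.orbitColor_of_mem hd _ hj, hφ.orbitColor_of_mem hd _ hj, Function.update_of_ne hji]
  · rw [orbitColor, orbitColor, dif_neg h, dif_neg h]

theorem orbitColor_update_of_mem (hφ : IsPeriodic D r φ) (hd : φ d ∉ D.vertex d)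
    (σ : ZMod r → CrossingState) (i : ZMod r) (k : CrossingState)
    (he : e ∈ D.orbitVertex φ d i) :
    D.orbitColor φ d (Function.update σ i k) e = k := by
  rw [hφ.orbitColor_of_mem hd _ he, Function.update_self]

theorem orbitColor_apply (hφ : IsPeriodic D r φ) (hd : φ d ∉ D.vertex d)
    (σ : ZMod r → CrossingState) (e : E) :
    D.orbitColor φ d σ (φ e) = D.orbitColor φ d (fun i => σ (i + 1)) e := by
  by_cases h : ∃ i : ZMod r, e ∈ D.orbitVertex φ d i
  · obtain ⟨i, hi⟩ := h
    rw [hφ.orbitColor_of_mem hd _ hi,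
      hφ.orbitColor_of_mem hd _ (hφ.apply_mem_orbitVertex_iff.2 hi)]
  · have h' : ¬ ∃ i : ZMod r, φ e ∈ D.orbitVertex φ d i := by
      rintro ⟨i, hi⟩
      rw [← sub_add_cancel i 1, hφ.apply_mem_orbitVertex_iff] at hi
      exact h ⟨_, hi⟩
    rw [orbitColor, orbitColor, dif_neg h, dif_neg h']

theorem isColoring_orbitColor (hφ : IsPeriodic D r φ) (hd : φ d ∉ D.vertex d)
    (hX : ∀ e ∈ D.orbit φ d, D.IsCrossing e) {M : Set E}
    (hM : ∀ e, D.IsCrossing e → (D.next e ∈ M ↔ e ∉ M)) (σ : ZMod r → CrossingState) :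
    D.IsColoring M (D.orbitColor φ d σ) where
  next e := by
    have hiff : ∀ i : ZMod r, D.next e ∈ D.orbitVertex φ d i ↔ e ∈ D.orbitVertex φ d i :=
      fun i => D.next_mem_vertex_iff
    by_cases h : ∃ i : ZMod r, e ∈ D.orbitVertex φ d i
    · obtain ⟨i, hi⟩ := h
      rw [hφ.orbitColor_of_mem hd _ hi, hφ.orbitColor_of_mem hd _ ((hiff i).2 hi)]
    · rw [orbitColor, orbitColor, dif_neg h, dif_neg (by simpa only [hiff] using h)]
  crossing e he := by
    by_contra h
    exact he (hφ.orbitColor_of_notMem σ fun h' => h (hX e h'))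
  alternating := hM

end IsPeriodic

/-! ### The Kauffman polynomial -/

namespace LinkDiagram

variable {E : Type} {D : LinkDiagram E}

theorem lower_alternating (D : LinkDiagram E) (e : E) (he : D.IsCrossing e) :
    D.next e ∈ {e | ¬ D.upper e} ↔ e ∉ {e | ¬ D.upper e} := by
  have := D.upper_crossing e he
  simp only [Set.mem_ofPred_eq]
  tauto

/-- Resolutions of `D` that differ only at the vertices in `V`, which are kept in the first,
form a skein quadruple. -/
theorem isSkeinQuadruple_resolve {V : Set E} {c₁ c₂ c₃ c₄ : E → CrossingState}
    (h₁ : D.IsColoring {e | ¬ D.upper e} c₁) (h₂ : D.IsColoring {e | ¬ D.upper e} c₂)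
    (h₃ : D.IsColoring {e | ¬ D.upper e} c₃) (h₄ : D.IsColoring {e | ¬ D.upper e} c₄)
    (hV : ∀ e ∈ V, D.IsCrossing e) (hkeep : ∀ e ∈ V, c₁ e = .keep)
    (hin₂ : ∀ e ∈ V, c₂ e = .switch) (hin₃ : ∀ e ∈ V, c₃ e = .zero)
    (hin₄ : ∀ e ∈ V, c₄ e = .inf) (hout₂ : ∀ e ∉ V, c₂ e = c₁ e)
    (hout₃ : ∀ e ∉ V, c₃ e = c₁ e) (hout₄ : ∀ e ∉ V, c₄ e = c₁ e) :
    (D.resolve h₁).IsSkeinQuadruple (D.resolve h₂) (D.resolve h₃) (D.resolve h₄) V where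
  crossing e he := (resolve_isCrossing_iff_of_keep h₁ (hkeep e he)).2 (hV e he)
  switch := resolve_isSwitch h₁ h₂ hout₂ hkeep hin₂
  smoothing_zero := (resolve_isSmoothing_zero h₁ h₃ hout₃ hkeep hin₃).congr fun e he =>
    not_congr (resolve_upper_of_keep h₁ (hkeep e he))
  smoothing_inf := (resolve_isSmoothing_inf h₁ h₄ hout₄ hkeep hin₄).congr fun e he => by
    simpa using resolve_upper_of_keep h₁ (hkeep e he)

end LinkDiagram

/-- The skein relation of a Kauffman polynomial along the orbit of a crossing. -/
theorem IsKauffmanPolynomial.periodic {Q : ∀ E : Type, LinkDiagram E → Laurent2}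
    (hQ : IsKauffmanPolynomial Q) {r : ℕ} (hr : r.Prime) {E : Type}
    {Dp Dm D0 Dinf : LinkDiagram E} {φ : Perm E} {d : E} (hφ : IsPeriodic Dp r φ)
    (hd : φ d ∉ Dp.vertex d) (h : Dp.IsSkeinQuadruple Dm D0 Dinf (Dp.orbit φ d)) :
    (Q E Dp + Q E Dm) - zPow 1 ^ r * (Q E D0 + Q E Dinf) ∈ Ideal.span {(r : Laurent2)} := by
  have : Fact r.Prime := ⟨hr⟩
  let f : Fin 4 → CrossingState := ![.keep, .switch, .zero, .inf]
  have hcol : ∀ σ : ZMod r → CrossingState,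
      Dp.IsColoring {e | ¬ Dp.upper e} (Dp.orbitColor φ d σ) :=
    hφ.isColoring_orbitColor hd h.crossing Dp.lower_alternating
  have hsum := sum_pow_mul_sub_mem_span hr (![1, 1, 0, 0] : Fin 4 → Laurent2)
    ![0, 0, zPow 1, zPow 1] (fun σ : ZMod r → Fin 4 => Q E (Dp.resolve (hcol (f ∘ σ)))) ?_ ?_
  · have hout : ∀ (σ : ZMod r → CrossingState), ∀ e ∉ Dp.orbit φ d,
        Dp.orbitColor φ d σ e = .keep := fun σ e => hφ.orbitColor_of_notMem σ
    have hc : ∀ k, ∀ e ∈ Dp.orbit φ d, Dp.orbitColor φ d (f ∘ fun _ : ZMod r => k) e = f k :=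
      fun k e => hφ.orbitColor_const (f k)
    have hp := hQ.iso _ _ _ _ _ (LinkDiagram.isIso_resolve_keep (hcol _) (hout _) (hc 0))
    have hm := hQ.iso _ _ _ _ _ (h.switch.isIso_resolve (hcol _) (hout _) (hc 1))
    have h0 := hQ.iso _ _ _ _ _ (h.smoothing_zero.isIso_resolve_zero (hcol _) (hout _) (hc 2))
    have hi := hQ.iso _ _ _ _ _ ((h.smoothing_inf.congr (M' := {e | ¬ Dp.upper e}ᶜ) fun e _ => by
      simp).isIso_resolve_inf (hcol _) (hout _) (hc 3))
    simp only [Fin.sum_univ_four, hp, hm, h0, hi] at hsum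
    simpa [hr.ne_zero, mul_add] using hsum
  · intro σ
    refine (hQ.iso _ _ _ _ φ (hφ.symmetry.resolve (hcol _) (hcol _)
      (fun e => hφ.orbitColor_apply hd (f ∘ σ) e) fun e => ?_)).symm
    simp [hφ.symmetry.upper]
  · intro i σ
    have hin : ∀ k, ∀ e ∈ Dp.orbitVertex φ d i,
        Dp.orbitColor φ d (f ∘ Function.update σ i k) e = f k := by
      intro k e he
      rw [Function.comp_update]
      exact hφ.orbitColor_update_of_mem hd _ i _ he
    have hout : ∀ k, ∀ e ∉ Dp.orbitVertex φ d i,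
        Dp.orbitColor φ d (f ∘ Function.update σ i k) e =
          Dp.orbitColor φ d (f ∘ Function.update σ i 0) e := by
      intro k e he
      rw [Function.comp_update, Function.comp_update, hφ.orbitColor_update_of_notMem hd _ i _ he,
        hφ.orbitColor_update_of_notMem hd _ i _ he]
    have hskein := hQ.skein E _ _ _ _ ((φ ^ i.val) d) (by
      rw [LinkDiagram.resolve_vertex_of_keep (hcol _) (hin 0 _ (Dp.mem_vertex_self _))]
      exact LinkDiagram.isSkeinQuadruple_resolve (hcol _) (hcol _) (hcol _) (hcol _)
        (fun e he => h.crossing e (hφ.mem_orbit_iff.2 ⟨i, he⟩)) (hin 0) (hin 1) (hin 2) (hin 3)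
        (hout 1) (hout 2) (hout 3))
    simpa [Fin.sum_univ_four, mul_add] using hskein

/-! ### Skein polynomials of oriented diagrams -/

namespace OrientedDiagram

variable {E : Type}

/-- The darts that are joined to their counterclockwise neighbours when the crossings are
smoothed in accordance with the orientation. -/
def turning (D : OrientedDiagram E) : Set E := {e | ¬ (D.out (D.next e) ↔ D.out e)}

theorem turning_alternating (D : OrientedDiagram E) (e : E) (he : D.IsCrossing e) :
    D.next e ∈ D.turning ↔ e ∉ D.turning := by
  have := D.out_crossing e he
  simp only [turning, Set.mem_ofPred_eq]
  tauto

/-- The oriented diagram obtained from `D` by changing its crossings as prescribed by `c`,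
where only smoothings in accordance with the orientation occur. -/
noncomputable def resolve (D : OrientedDiagram E) {c : E → CrossingState}
    (h : D.IsColoring D.turning c) (hinf : ∀ e, c e ≠ .inf) : OrientedDiagram E where
  toLinkDiagram := D.toLinkDiagram.resolve h
  out := D.out
  out_edge := D.out_edge
  out_crossing e he := by
    have hz : c e ≠ .zero := fun hz => he (h.resolveNext_resolveNext (Or.inl hz))
    change h.resolveNext (h.resolveNext e) ≠ e at he
    change D.out (h.resolveNext (h.resolveNext e)) ↔ _
    rw [h.resolveNext_resolveNext_of_ne hz (hinf e)] at he ⊢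
    exact D.out_crossing e he
  out_marked e he := by
    change h.resolveNext (h.resolveNext e) = e at he
    change D.out (h.resolveNext e) ↔ _
    by_cases hz : c e = .zero
    · by_cases hm : e ∈ D.turning
      · rw [h.resolveNext_zero_mem hz hm]
        simp only [turning, Set.mem_ofPred_eq] at hm
        tauto
      · rw [h.resolveNext_zero_notMem hz hm, D.next_symm_eq]
        have hX := h.crossing e (by simp [hz])
        have := D.out_crossing (D.next e) ((D.isCrossing_next_iff e).2 hX)
        simp only [turning, Set.mem_ofPred_eq] at hm
        tauto
    · rw [h.resolveNext_resolveNext_of_ne hz (hinf e)] at he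
      rw [h.resolveNext_of_ne hz (hinf e)]
      exact D.out_marked e he

theorem isSkeinTriple_resolve {D : OrientedDiagram E} {V : Set E} {c₁ c₂ c₃ : E → CrossingState}
    (h₁ : D.IsColoring D.turning c₁) (h₂ : D.IsColoring D.turning c₂)
    (h₃ : D.IsColoring D.turning c₃) (hinf₁ : ∀ e, c₁ e ≠ .inf) (hinf₂ : ∀ e, c₂ e ≠ .inf)
    (hinf₃ : ∀ e, c₃ e ≠ .inf) (hV : ∀ e ∈ V, D.IsCrossing e)
    (hpos : ∀ e ∈ V, D.out e → D.out (D.next e) → D.upper e) (hkeep : ∀ e ∈ V, c₁ e = .keep)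
    (hin₂ : ∀ e ∈ V, c₂ e = .switch) (hin₃ : ∀ e ∈ V, c₃ e = .zero)
    (hout₂ : ∀ e ∉ V, c₂ e = c₁ e) (hout₃ : ∀ e ∉ V, c₃ e = c₁ e) :
    (D.resolve h₁ hinf₁).IsSkeinTriple (D.resolve h₂ hinf₂) (D.resolve h₃ hinf₃) V := by
  have hnext : ∀ e ∈ V, (D.resolve h₁ hinf₁).next e = D.next e := fun e he =>
    LinkDiagram.resolve_next_of_ne h₁ (by simp [hkeep e he]) (by simp [hkeep e he])
  exact {
    crossing := fun e he =>
      (LinkDiagram.resolve_isCrossing_iff_of_keep h₁ (hkeep e he)).2 (hV e he)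
    positive := fun e he ho hn =>
      (LinkDiagram.resolve_upper_of_keep h₁ (hkeep e he)).2 (hpos e he ho (hnext e he ▸ hn))
    switch := LinkDiagram.resolve_isSwitch h₁ h₂ hout₂ hkeep hin₂
    switch_out := fun e => Iff.rfl
    smoothing := (LinkDiagram.resolve_isSmoothing_zero h₁ h₃ hout₃ hkeep hin₃).congr fun e he => by
      rw [Set.mem_ofPred_eq, hnext e he]
      rfl
    smoothing_out := fun e => Iff.rfl }

/-- The diagram with the orientations of all components reversed. -/
def reverse (D : OrientedDiagram E) : OrientedDiagram E where
  toLinkDiagram := D.toLinkDiagram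
  out e := ¬ D.out e
  out_edge e := not_congr (D.out_edge e)
  out_crossing e he := not_congr (D.out_crossing e he)
  out_marked e he := not_congr (D.out_marked e he)

end OrientedDiagram

/-- Reversing the orientation of all diagrams turns a skein polynomial into a skein
polynomial, because it preserves the signs of the crossings. -/
theorem IsSkeinPolynomial.reverse {s t : Laurent2} {P : ∀ E : Type, OrientedDiagram E → Laurent2}
    (hP : IsSkeinPolynomial s t P) : IsSkeinPolynomial s t fun E D => P E D.reverse where
  iso E E' D D' f h ho := hP.iso E E' D.reverse D'.reverse f h fun e => not_congr (ho e)
  subdivision E E' D D' ι e p q h ho :=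
    hP.subdivision E E' D.reverse D'.reverse ι e p q h fun x => not_congr (ho x)
  kink E D D' d h ho := hP.kink E D.reverse D'.reverse d h fun e he => not_congr (ho e he)
  bigon E D D' x y h ho := hP.bigon E D.reverse D'.reverse x y h fun e he => not_congr (ho e he)
  triangle E D D' a b c h ho :=
    hP.triangle E D.reverse D'.reverse a b c h fun e => not_congr (ho e)
  unknot E D h := hP.unknot E D.reverse h
  skein E Dp Dm D0 d h := by
    refine hP.skein E Dp.reverse Dm.reverse D0.reverse d ⟨h.crossing, ?_, h.switch,
      fun e => not_congr (h.switch_out e), ?_, fun e => not_congr (h.smoothing_out e)⟩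
    · -- the incoming darts are opposite to the outgoing ones of the same strands
      intro e he ho hn
      have hX := h.crossing e he
      have hX' := (Dp.isCrossing_next_iff e).2 hX
      have h1 := Dp.out_crossing e hX
      have h2 := Dp.out_crossing (Dp.next e) hX'
      have h3 := h.positive (Dp.next (Dp.next e))
        (Dp.next_mem_vertex_iff.2 (Dp.next_mem_vertex_iff.2 he)) (h1.2 ho) (h2.2 hn)
      have h4 := Dp.upper_crossing e hX
      have h5 := Dp.upper_crossing (Dp.next e) hX'
      change Dp.upper e
      tauto
    · refine h.smoothing.congr fun e _ => ?_
      simp only [OrientedDiagram.reverse, Set.mem_ofPred_eq]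
      tauto

/-- The skein relation of a skein polynomial along the orbit of a crossing. -/
theorem IsSkeinPolynomial.periodic {s t : Laurent2} {P : ∀ E : Type, OrientedDiagram E → Laurent2}
    (hP : IsSkeinPolynomial s t P) (hrev : ∀ E (D : OrientedDiagram E), P E D.reverse = P E D)
    {r : ℕ} (hr : r.Prime) {E : Type} {Dp Dm D0 : OrientedDiagram E} {φ : Perm E} {d : E}
    (hφ : IsPeriodicOriented Dp r φ) (hd : φ d ∉ Dp.vertex d)
    (h : Dp.IsSkeinTriple Dm D0 (Dp.orbit φ d)) :
    s ^ r * P E Dp + t ^ r * P E Dm - zPow 1 ^ r * P E D0 ∈ Ideal.span {(r : Laurent2)} := by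
  have : Fact r.Prime := ⟨hr⟩
  have hφ' := hφ.periodic
  let f : Fin 3 → CrossingState := ![.keep, .switch, .zero]
  have hf : ∀ k, f k ≠ .inf := by
    intro k
    fin_cases k <;> simp [f]
  have hcol : ∀ σ : ZMod r → CrossingState, Dp.IsColoring Dp.turning (Dp.orbitColor φ d σ) :=
    hφ'.isColoring_orbitColor hd h.crossing Dp.turning_alternating
  have hinf : ∀ (σ : ZMod r → Fin 3) e, Dp.orbitColor φ d (f ∘ σ) e ≠ .inf := by
    intro σ e
    unfold LinkDiagram.orbitColor
    split_ifs
    · exact hf _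
    · simp
  have hsum := sum_pow_mul_sub_mem_span hr (![s, t, 0] : Fin 3 → Laurent2) ![0, 0, zPow 1]
    (fun σ : ZMod r → Fin 3 => P E (Dp.resolve (hcol (f ∘ σ)) (hinf σ))) ?_ ?_
  · have hout : ∀ (σ : ZMod r → CrossingState), ∀ e ∉ Dp.orbit φ d,
        Dp.orbitColor φ d σ e = .keep := fun σ e => hφ'.orbitColor_of_notMem σ
    have hc : ∀ k, ∀ e ∈ Dp.orbit φ d, Dp.orbitColor φ d (f ∘ fun _ : ZMod r => k) e = f k :=
      fun k e => hφ'.orbitColor_const (f k)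
    have hp := hP.iso _ _ Dp (Dp.resolve (hcol _) (hinf _)) _
      (LinkDiagram.isIso_resolve_keep (hcol _) (hout _) (hc 0)) fun e => Iff.rfl
    have hm := hP.iso _ _ Dm (Dp.resolve (hcol _) (hinf _)) _
      (h.switch.isIso_resolve (hcol _) (hout _) (hc 1)) fun e => (h.switch_out e).symm
    have h0 := hP.iso _ _ D0 (Dp.resolve (hcol _) (hinf _)) _
      (h.smoothing.isIso_resolve_zero (hcol _) (hout _) (hc 2)) fun e => (h.smoothing_out e).symm
    simp only [Fin.sum_univ_three, hp, hm, h0] at hsum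
    simpa [hr.ne_zero] using hsum
  · intro σ
    have hiso : ∀ (hM : ∀ e, φ e ∈ Dp.turning ↔ e ∈ Dp.turning),
        (Dp.toLinkDiagram.resolve (hcol (f ∘ fun i => σ (i + 1)))).IsIso
          (Dp.toLinkDiagram.resolve (hcol (f ∘ σ))) φ :=
      hφ'.symmetry.resolve (hcol _) (hcol _) fun e => hφ'.orbitColor_apply hd (f ∘ σ) e
    rcases hφ.orientation with ho | ho
    · refine (hP.iso _ _ (Dp.resolve (hcol _) (hinf _)) (Dp.resolve (hcol _) (hinf _)) φ
        (hiso fun e => ?_) ho).symm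
      simp [OrientedDiagram.turning, hφ'.symmetry.next, ho]
    · rw [← hrev]
      refine (hP.iso _ _ (Dp.resolve (hcol _) (hinf _)).reverse (Dp.resolve (hcol _) (hinf _)) φ
        (hiso fun e => ?_) ho).symm
      simp only [OrientedDiagram.turning, Set.mem_ofPred_eq, hφ'.symmetry.next, ho]
      tauto
  · intro i σ
    have hin : ∀ k, ∀ e ∈ Dp.orbitVertex φ d i,
        Dp.orbitColor φ d (f ∘ Function.update σ i k) e = f k := by
      intro k e he
      rw [Function.comp_update]
      exact hφ'.orbitColor_update_of_mem hd _ i _ he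
    have hout : ∀ k, ∀ e ∉ Dp.orbitVertex φ d i,
        Dp.orbitColor φ d (f ∘ Function.update σ i k) e =
          Dp.orbitColor φ d (f ∘ Function.update σ i 0) e := by
      intro k e he
      rw [Function.comp_update, Function.comp_update, hφ'.orbitColor_update_of_notMem hd _ i _ he,
        hφ'.orbitColor_update_of_notMem hd _ i _ he]
    have hmem : ∀ e ∈ Dp.orbitVertex φ d i, e ∈ Dp.orbit φ d :=
      fun e he => hφ'.mem_orbit_iff.2 ⟨i, he⟩
    have hskein := hP.skein E (Dp.resolve (hcol (f ∘ Function.update σ i 0)) (hinf _))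
      (Dp.resolve (hcol (f ∘ Function.update σ i 1)) (hinf _))
      (Dp.resolve (hcol (f ∘ Function.update σ i 2)) (hinf _)) ((φ ^ i.val) d) (by
      have hvertex := LinkDiagram.resolve_vertex_of_keep (hcol (f ∘ Function.update σ i 0))
        (hin 0 _ (Dp.mem_vertex_self _))
      change OrientedDiagram.IsSkeinTriple _ _ _ (LinkDiagram.vertex (LinkDiagram.resolve _ _) _)
      rw [hvertex]
      exact OrientedDiagram.isSkeinTriple_resolve (hcol _) (hcol _) (hcol _) (hinf _) (hinf _)
        (hinf _) (fun e he => h.crossing e (hmem e he)) (fun e he => h.positive e (hmem e he))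
        (hin 0) (hin 1) (hin 2) (hout 1) (hout 2))
    simpa [Fin.sum_univ_three] using hskein

theorem skeinPolynomial_periodic (s t : Laurent2) {r : ℕ} (hr : r.Prime) {E : Type}
    {Dp Dm D0 : OrientedDiagram E} {φ : Perm E} {d : E}
    (hφ : IsPeriodicOriented Dp r φ) (hd : φ d ∉ Dp.vertex d)
    (h : Dp.IsSkeinTriple Dm D0 (Dp.orbit φ d)) :
    s ^ r * skeinPolynomial s t Dp + t ^ r * skeinPolynomial s t Dm -
      zPow 1 ^ r * skeinPolynomial s t D0 ∈ Ideal.span {(r : Laurent2)} := by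
  by_cases hex : ∃! P, IsSkeinPolynomial s t P
  · simp only [skeinPolynomial, dif_pos hex]
    obtain ⟨hP, huniq⟩ := hex.choose_spec
    -- the orientation of all components may be reversed, by uniqueness
    refine hP.periodic (fun E D => ?_) hr hφ hd h
    exact congrFun (congrFun (huniq _ hP.reverse) E) D
  · -- without a unique invariant the definition has the value `0` by convention
    simp [skeinPolynomial, dif_neg hex]

theorem kauffmanPolynomial_periodic {r : ℕ} (hr : r.Prime) {E : Type}
    {Dp Dm D0 Dinf : LinkDiagram E} {φ : Perm E} {d : E} (hφ : IsPeriodic Dp r φ)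
    (hd : φ d ∉ Dp.vertex d) (h : Dp.IsSkeinQuadruple Dm D0 Dinf (Dp.orbit φ d)) :
    (kauffmanPolynomial Dp + kauffmanPolynomial Dm) -
      zPow 1 ^ r * (kauffmanPolynomial D0 + kauffmanPolynomial Dinf) ∈
        Ideal.span {(r : Laurent2)} := by
  by_cases hex : ∃! Q, IsKauffmanPolynomial Q
  · simp only [kauffmanPolynomial, dif_pos hex]
    exact hex.choose_spec.1.periodic hr hφ hd h
  · -- without a unique invariant the definition has the value `0` by convention
    simp [kauffmanPolynomial, dif_neg hex]

/-! ### The congruences -/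

theorem aPow_pow (m : ℤ) (n : ℕ) : aPow m ^ n = aPow (n * m) := by
  rw [aPow, aPow, ← map_pow, LaurentPolynomial.T_pow]

theorem zPow_pow (m : ℤ) (n : ℕ) : zPow m ^ n = zPow (n * m) :=
  LaurentPolynomial.T_pow m n

theorem sub_pow_mul_mem_span {R : Type*} [CommRing R] {r : ℕ} (hr : r.Prime) {x y p w : R}
    (h : y + (-x) ^ r * p - w ∈ Ideal.span {(r : R)}) :
    y - x ^ r * p - w ∈ Ideal.span {(r : R)} := by
  rcases hr.eq_two_or_odd' with rfl | hodd
  · -- for `r = 2` the sign is not the expected one, but modulo `2` it does not matter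
    have h2 : ((2 : ℕ) : R) * (x ^ 2 * p) ∈ Ideal.span {((2 : ℕ) : R)} :=
      Ideal.mul_mem_right _ _ (Ideal.mem_span_singleton_self _)
    convert sub_mem h h2 using 1
    push_cast
    ring
  · rwa [hodd.neg_pow, neg_mul, ← sub_eq_add_neg] at h

theorem lemma4p9 (r : ℕ) (hr : r.Prime) :
    (∀ (E : Type) (Dp Dm D0 : OrientedDiagram E) (φ : Equiv.Perm E) (d : E),
      IsPeriodicOriented Dp r φ →
      φ d ∉ Dp.vertex d →
      Dp.IsSkeinTriple Dm D0 (Dp.orbit φ d) →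
      (aPow r * homflypt Dp + aPow (-r) * homflypt Dm - zPow r * homflypt D0
          ∈ Ideal.span {(r : Laurent2)}) ∧
      (aPow (-r) * homflyptV Dp - aPow r * homflyptV Dm - zPow r * homflyptV D0
          ∈ Ideal.span {(r : Laurent2)})) ∧
    (∀ (E : Type) (Dp Dm D0 Dinf : LinkDiagram E) (φ : Equiv.Perm E) (d : E),
      IsPeriodic Dp r φ →
      φ d ∉ Dp.vertex d →
      Dp.IsSkeinQuadruple Dm D0 Dinf (Dp.orbit φ d) →
      (kauffmanPolynomial Dp + kauffmanPolynomial Dm)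
          - zPow r * (kauffmanPolynomial D0 + kauffmanPolynomial Dinf)
        ∈ Ideal.span {(r : Laurent2)}) := by
  refine ⟨fun E Dp Dm D0 φ d hφ hd h => ⟨?_, ?_⟩, fun E Dp Dm D0 Dinf φ d hφ hd h => ?_⟩
  · simpa [aPow_pow, zPow_pow, homflypt] using
      skeinPolynomial_periodic (aPow 1) (aPow (-1)) hr hφ hd h
  · have key := sub_pow_mul_mem_span hr
      (skeinPolynomial_periodic (aPow (-1)) (-aPow 1) hr hφ hd h)
    rw [aPow_pow, aPow_pow, zPow_pow, mul_neg_one, mul_one] at key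
    exact key
  · simpa [zPow_pow] using kauffmanPolynomial_periodic hr hφ hd h
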